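/- **Setting.** Let $\mathbb R^{1,1}$ be two-dimensional Minkowski space-time with coordinates $(x^0,x^1)$ and metric $g=\mathrm{diag}(-1,1)$. A (future directed) causal curve is a piecewise $C^1$ curve whose velocity satisfies $g(\dot\gamma,\dot\gamma)\le 0$ and $\dot\gamma_0>0$; the trivial curve at a single point, of length $0$, is also admitted. Its length is $l(\gamma)=\int\sqrt{-g(\dot\gamma(t),\dot\gamma(t))}\,dt$, and $p\preceq q$ means that there is a causal curve from $p$ to $q$. Let $\mathcal C_{\mathcal M}$ be the set of smooth bounded real functions on $\mathbb R^{1,1}$, with all derivatives bounded, that are non-decreasing along every causal curve, and let $\mathcal S(\mathbb R^{1,1})$ be the Schwartz space. Put $$\widetilde{\mathcal A}=\begin{pmatrix}\mathrm{Span}_{\mathbb C}(\mathcal C_{\mathcal M})&\mathcal S(\mathbb R^{1,1})\\ \mathcal S(\mathbb R^{1,1})&\mathrm{Span}_{\mathbb C}(\mathcal C_{\mathcal M})\end{pmatrix},$$ a unitisation of $\mathcal S(\mathbb R^{1,1})\otimes M_2(\mathbb C)$, acting by pointwise multiplication on $\mathcal H=L^2(\mathbb R^{1,1})\otimes\mathbb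 C^2\otimes\mathbb C^2$ (trivially on the first, spinor, factor $\mathbb C^2$). Let $$\gamma^0=\begin{pmatrix}0&i\\ i&0\end{pmatrix},\quad \gamma^1=\begin{pmatrix}0&-i\\ i&0\end{pmatrix},\quad D=-i\gamma^\mu\partial_\mu\otimes 1+\gamma^0\gamma^1\otimes\mathrm{diag}(d_1,d_2),\quad \mathcal J=i\gamma^0\otimes 1,$$ with $d_1,d_2\in\mathbb R$, $d_1\neq d_2$, and $D$ densely defined on the Schwartz spinor fields. Let $\mathcal C$ be the set of Hermitian $\mathbf a\in\widetilde{\mathcal A}$ such that $\langle\phi,\mathcal J[D,\mathbf a]\phi\rangle\le 0$ for all $\phi\in\mathcal H$, where $[D,\mathbf a]$ denotes the bounded extension of the commutator. For functionals $\omega,\eta$ on $\widetilde{\mathcal A}$ write $\omega\preceq\eta$ if $\omega(\mathbf a)\le\eta(\mathbf a)$ for all $\mathbf a\in\mathcal C$. For $p\in\mathbb R^{1,1}$ and a unit vector $\xi=(\xi_1,\xi_2)\in\mathbb C^2$ let $\omega_{p,\xi}(\mathbf a)=\xi^*\mathbf a(p)\xi$. The latitude of $\xi$ is $z_\xi=|\xi_1|^2-|\xi_2|^2$,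 and $\theta_\xi$ is the argument of $\xi_1^*\xi_2$. For $\xi,\varphi$ of the same latitude, $|\theta_\varphi-\theta_\xi|\in[0,\pi]$ denotes the angle between their positions on the parallel of latitude, i.e. the absolute value of the representative of $\theta_\varphi-\theta_\xi$ modulo $2\pi$ in $(-\pi,\pi]$; it is $0$ if $\xi_1\xi_2=0$, where the parallel is a single point. **Theorem.** Let $p,q\in\mathbb R^{1,1}$ and let $\xi,\varphi\in\mathbb C^2$ be unit vectors. Then $\omega_{p,\xi}\preceq\omega_{q,\varphi}$ if and only if the following three conditions hold: 1. $p\preceq q$ in $\mathbb R^{1,1}$; 2. $\xi$ and $\varphi$ have the same latitude, $z_\xi=z_\varphi$; 3. there is a causal curve $\gamma$ from $p$ to $q$ with $l(\gamma)\ge\dfrac{|\theta_\varphi-\theta_\xi|}{|d_1-d_2|}$. -/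

import Mathlib

noncomputable section

namespace AlmostCommutative

open MeasureTheory
open scoped SchwartzMap ContDiff Kronecker ComplexConjugate ComplexOrder

/-! ## Two-dimensional Minkowski space-time -/

/-- Points (and tangent vectors) `(x⁰, x¹)` of `ℝ^{1,1}`. -/
abbrev Minkowski : Type := ℝ × ℝ

/-- The flat metric, of signature `(-, +)`. -/
def metric (v w : Minkowski) : ℝ := -(v.1 * w.1) + v.2 * w.2

/-- Future directed causal (timelike or null, hence nonzero) tangent vectors. -/
def IsFutureCausal (v : Minkowski) : Prop := metric v v ≤ 0 ∧ 0 < v.1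

/-- `γ` restricted to `[a, b]` is a piecewise `C¹` future directed causal curve. The one-point
interval `a = b` (no pieces) is allowed: this is the trivial curve at a point. -/
def IsCausalCurve (γ : ℝ → Minkowski) (a b : ℝ) : Prop :=
  ∃ (n : ℕ) (s : ℕ → ℝ), s 0 = a ∧ s n = b ∧ ∀ i < n,
    s i < s (i + 1) ∧
    ContDiffOn ℝ 1 γ (Set.Icc (s i) (s (i + 1))) ∧
    ∀ t ∈ Set.Icc (s i) (s (i + 1)),
      IsFutureCausal (derivWithin γ (Set.Icc (s i) (s (i + 1))) t)

/-- The (Lorentzian) length, i.e. the proper time, of a curve. -/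
def curveLength (γ : ℝ → Minkowski) (a b : ℝ) : ℝ :=
  ∫ t in a..b, √(-metric (deriv γ t) (deriv γ t))

/-- The causal relation `p ⪯ q` of Minkowski space-time. -/
def Precedes (p q : Minkowski) : Prop :=
  ∃ (γ : ℝ → Minkowski) (a b : ℝ), IsCausalCurve γ a b ∧ γ a = p ∧ γ b = q

/-! ## The algebras -/

/-- Smooth bounded real functions, with all derivatives bounded, which are non-decreasing along
every future directed causal curve. -/
structure IsCausalFunction (f : Minkowski → ℝ) : Prop where
  smooth : ContDiff ℝ ∞ f
  bounded : ∀ n : ℕ, ∃ C : ℝ, ∀ x, ‖iteratedFDeriv ℝ n f x‖ ≤ C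
  mono : ∀ (γ : ℝ → Minkowski) (a b : ℝ), IsCausalCurve γ a b →
    MonotoneOn (fun t => f (γ t)) (Set.Icc a b)

/-- The unitisation of the Schwartz algebra: the complex span of the causal functions. -/
def unitisationM : Submodule ℂ (Minkowski → ℂ) :=
  Submodule.span ℂ {g | ∃ f : Minkowski → ℝ, IsCausalFunction f ∧ g = fun x => (f x : ℂ)}

/-- The Schwartz functions, as a space of functions. -/
def schwartzM : Submodule ℂ (Minkowski → ℂ) where
  carrier := {g | ∃ f : 𝓢(Minkowski, ℂ), ⇑f = g}
  add_mem' := by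
    rintro _ _ ⟨f, rfl⟩ ⟨g, rfl⟩
    exact ⟨f + g, rfl⟩
  zero_mem' := ⟨0, rfl⟩
  smul_mem' := by
    rintro c _ ⟨f, rfl⟩
    exact ⟨c • f, rfl⟩

/-- The unitisation of `𝓢(ℝ^{1,1}) ⊗ M₂(ℂ)`: matrix valued functions with diagonal entries in
the span of the causal functions and with Schwartz off-diagonal entries. -/
def unitisation : Submodule ℂ (Minkowski → Matrix (Fin 2) (Fin 2) ℂ) where
  carrier := {a | (∀ i, (fun x => a x i i) ∈ unitisationM) ∧
    ∀ i j, i ≠ j → (fun x => a x i j) ∈ schwartzM}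
  add_mem' := fun ha hb =>
    ⟨fun i => unitisationM.add_mem (ha.1 i) (hb.1 i),
      fun i j h => schwartzM.add_mem (ha.2 i j h) (hb.2 i j h)⟩
  zero_mem' := ⟨fun _ => unitisationM.zero_mem, fun _ _ _ => schwartzM.zero_mem⟩
  smul_mem' := fun c _ ha =>
    ⟨fun i => unitisationM.smul_mem c (ha.1 i),
      fun i j h => schwartzM.smul_mem c (ha.2 i j h)⟩

/-! ## The Hilbert space, the fundamental symmetry and the Dirac operator -/

/-- The fibre `ℂ² ⊗ ℂ²`; the first index is the spinor index, the second one is internal. -/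
abbrev Fibre : Type := EuclideanSpace ℂ (Fin 2 × Fin 2)

/-- The Hilbert space `L²(ℝ^{1,1}) ⊗ ℂ² ⊗ ℂ²`. -/
abbrev HilbertSpace : Type := Lp Fibre 2 (volume : Measure Minkowski)

/-- The operator on the fibre given by `g ⊗ m`. -/
def fibreOp (g m : Matrix (Fin 2) (Fin 2) ℂ) : Fibre →L[ℂ] Fibre :=
  Matrix.toEuclideanCLM (n := Fin 2 × Fin 2) (𝕜 := ℂ) (g ⊗ₖ m)

/-- The flat gamma matrix `γ⁰`. -/
def gamma0 : Matrix (Fin 2) (Fin 2) ℂ := !![0, Complex.I; Complex.I, 0]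

/-- The flat gamma matrix `γ¹`. -/
def gamma1 : Matrix (Fin 2) (Fin 2) ℂ := !![0, -Complex.I; Complex.I, 0]

/-- The fundamental symmetry `𝒥 = iγ⁰ ⊗ 1`. -/
def fundamentalSymmetry : HilbertSpace →L[ℂ] HilbertSpace :=
  (fibreOp (Complex.I • gamma0) 1).compLpL 2 volume

/-- The Dirac operator `-iγ^μ∂_μ ⊗ 1 + γ⁰γ¹ ⊗ diag(d₁, d₂)` on Schwartz spinor fields. -/
def diracSchwartz (d₁ d₂ : ℝ) : 𝓢(Minkowski, Fibre) →ₗ[ℂ] 𝓢(Minkowski, Fibre) :=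
  (SchwartzMap.postcompCLM (fibreOp (-Complex.I • gamma0) 1) ∘L
      LineDeriv.lineDerivOpCLM ℂ 𝓢(Minkowski, Fibre) ((1, 0) : Minkowski) +
    SchwartzMap.postcompCLM (fibreOp (-Complex.I • gamma1) 1) ∘L
      LineDeriv.lineDerivOpCLM ℂ 𝓢(Minkowski, Fibre) ((0, 1) : Minkowski) +
    SchwartzMap.postcompCLM (fibreOp (gamma0 * gamma1) (Matrix.diagonal ![(d₁ : ℂ), (d₂ : ℂ)])) :
    𝓢(Minkowski, Fibre) →L[ℂ] 𝓢(Minkowski, Fibre)).toLinearMap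

/-- The inclusion of the Schwartz spinor fields in the Hilbert space. -/
def schwartzIncl : 𝓢(Minkowski, Fibre) →ₗ[ℂ] HilbertSpace :=
  (SchwartzMap.toLpCLM ℂ Fibre 2 (volume : Measure Minkowski)).toLinearMap

theorem schwartzIncl_injective : Function.Injective schwartzIncl :=
  SchwartzMap.injective_toLp 2 volume

/-- The Dirac operator, as an unbounded operator on the Hilbert space with dense domain
the Schwartz spinor fields. -/
def dirac (d₁ d₂ : ℝ) : HilbertSpace →ₗ.[ℂ] HilbertSpace where
  domain := LinearMap.range schwartzIncl
  toFun := schwartzIncl ∘ₗ diracSchwartz d₁ d₂ ∘ₗ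
    (LinearEquiv.ofInjective schwartzIncl schwartzIncl_injective).symm.toLinearMap

/-! ## The representation -/

theorem continuous_bounded_of_mem_unitisationM {g : Minkowski → ℂ} (hg : g ∈ unitisationM) :
    Continuous g ∧ ∃ C : ℝ, ∀ x, ‖g x‖ ≤ C := by
  induction hg using Submodule.span_induction with
  | mem g hg =>
    obtain ⟨f, hf, rfl⟩ := hg
    obtain ⟨C, hC⟩ := hf.bounded 0
    exact ⟨Complex.continuous_ofReal.comp hf.smooth.continuous, C, fun x => by simpa using hC x⟩
  | zero => exact ⟨continuous_const, 0, fun x => by simp⟩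
  | add f g _ _ hf hg =>
    obtain ⟨hf, C, hC⟩ := hf
    obtain ⟨hg, E, hE⟩ := hg
    exact ⟨hf.add hg, C + E, fun x => (norm_add_le _ _).trans (add_le_add (hC x) (hE x))⟩
  | smul c f _ hf =>
    obtain ⟨hf, C, hC⟩ := hf
    refine ⟨hf.const_smul c, ‖c‖ * C, fun x => ?_⟩
    rw [Pi.smul_apply, norm_smul]
    exact mul_le_mul_of_nonneg_left (hC x) (norm_nonneg c)

theorem continuous_bounded_of_mem_schwartzM {g : Minkowski → ℂ} (hg : g ∈ schwartzM) :
    Continuous g ∧ ∃ C : ℝ, ∀ x, ‖g x‖ ≤ C := by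
  obtain ⟨f, rfl⟩ := hg
  exact ⟨f.continuous, _, fun x => SchwartzMap.norm_le_seminorm ℝ f x⟩

theorem continuous_bounded_entry (a : unitisation) (i j : Fin 2) :
    Continuous (fun x => a.1 x i j) ∧ ∃ C : ℝ, ∀ x, ‖a.1 x i j‖ ≤ C := by
  by_cases h : i = j
  · subst h
    exact continuous_bounded_of_mem_unitisationM (a.2.1 i)
  · exact continuous_bounded_of_mem_schwartzM (a.2.2 i j h)

theorem memLp_symbol (a : unitisation) :
    MemLp (fun x => fibreOp 1 (a.1 x)) ⊤ (volume : Measure Minkowski) := by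
  let L : Matrix (Fin 2) (Fin 2) ℂ →ₗ[ℂ] (Fibre →L[ℂ] Fibre) :=
    { toFun := fibreOp 1
      map_add' := fun m n => by simp [fibreOp, Matrix.kronecker_add]
      map_smul' := fun c m => by simp [fibreOp, Matrix.kronecker_smul] }
  have key : (fun x => fibreOp 1 (a.1 x)) =
      fun x => ∑ i, ∑ j, (a.1 x i j) • fibreOp 1 (Matrix.single i j 1) := by
    funext x
    change L (a.1 x) = ∑ i, ∑ j, (a.1 x i j) • L (Matrix.single i j 1)
    conv_lhs => rw [Matrix.matrix_eq_sum_single (a.1 x)]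
    simp only [map_sum, ← map_smul, Matrix.smul_single, smul_eq_mul, mul_one]
  choose hc C hC using continuous_bounded_entry a
  refine memLp_top_of_bound (C := ∑ i, ∑ j, C i j * ‖fibreOp 1 (Matrix.single i j 1)‖) ?_
    (Filter.Eventually.of_forall fun x => ?_)
  · rw [key]
    exact (continuous_finsetSum _ fun i _ => continuous_finsetSum _ fun j _ =>
      (hc i j).smul continuous_const).aestronglyMeasurable
  · rw [congrFun key x]
    refine (norm_sum_le _ _).trans (Finset.sum_le_sum fun i _ =>
      (norm_sum_le _ _).trans (Finset.sum_le_sum fun j _ => ?_))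
    rw [norm_smul]
    exact mul_le_mul_of_nonneg_right (hC i j x) (norm_nonneg _)

/-- The representation of the unitisation by bounded operators:
`(π(a)ψ)(x) = (1 ⊗ a(x)) ψ(x)`. -/
def represent (a : unitisation) : HilbertSpace →L[ℂ] HilbertSpace :=
  (ContinuousLinearMap.id ℂ (Fibre →L[ℂ] Fibre)).holderL volume ⊤ 2 2 (memLp_symbol a).toLp

theorem coeFn_represent (a : unitisation) (ψ : HilbertSpace) :
    represent a ψ =ᵐ[volume] fun x => fibreOp 1 (a.1 x) (ψ x) := by
  have h := (ContinuousLinearMap.id ℂ (Fibre →L[ℂ] Fibre)).coeFn_holder (r := 2)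
    (memLp_symbol a).toLp ψ
  filter_upwards [h, (memLp_symbol a).coeFn_toLp] with x h1 h2
  exact h1.trans (by rw [h2]; rfl)

/-! ## The causal cone and the causal relation -/

/-- The bounded operator `B` extends the commutator `[D, a]`. -/
def ExtendsCommutator (d₁ d₂ : ℝ) (a : unitisation) (B : HilbertSpace →L[ℂ] HilbertSpace) :
    Prop :=
  ∀ ψ : (dirac d₁ d₂).domain, ∃ h : represent a ψ ∈ (dirac d₁ d₂).domain,
    B ψ = dirac d₁ d₂ ⟨represent a ψ, h⟩ - represent a (dirac d₁ d₂ ψ)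

/-- The causal cone: the Hermitian elements `a` with `⟨φ, 𝒥[D, a]φ⟩ ≤ 0` for all `φ` in the
Hilbert space, where `[D, a]` is the bounded extension of the commutator. (The order on `ℂ` is
such that `z ≤ 0` means that `z` is real and non-positive.) -/
def causalCone (d₁ d₂ : ℝ) : Set unitisation :=
  {a | (∀ x, (a.1 x).IsHermitian) ∧
    ∃ B : HilbertSpace →L[ℂ] HilbertSpace, ExtendsCommutator d₁ d₂ a B ∧
      ∀ φ : HilbertSpace, inner ℂ φ (fundamentalSymmetry (B φ)) ≤ 0}

/-- The causal relation between functionals (in particular states) on the unitisation. -/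
def CausallyPrecedes (d₁ d₂ : ℝ) (σ τ : unitisation →ₗ[ℂ] ℂ) : Prop :=
  ∀ a ∈ causalCone d₁ d₂, σ a ≤ τ a

/-! ## Pure states -/

/-- The state `ω_{p,ξ}(a) = ξ* a(p) ξ`, for a normalised vector `ξ`. -/
def pureState (p : Minkowski) (ξ : EuclideanSpace ℂ (Fin 2)) : unitisation →ₗ[ℂ] ℂ where
  toFun a := ∑ i, ∑ j, conj (ξ i) * a.1 p i j * ξ j
  map_add' a b := by
    simp [mul_add, add_mul, Finset.sum_add_distrib]
  map_smul' c a := by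
    simp only [Submodule.coe_smul, Pi.smul_apply, Matrix.smul_apply, smul_eq_mul,
      RingHom.id_apply, Finset.mul_sum]
    exact Finset.sum_congr rfl fun i _ => Finset.sum_congr rfl fun j _ => by ring

/-- The latitude `z_ξ = |ξ₁|² - |ξ₂|²` on the sphere. -/
def latitude (ξ : EuclideanSpace ℂ (Fin 2)) : ℝ := ‖ξ 0‖ ^ 2 - ‖ξ 1‖ ^ 2

/-- The position `θ_ξ` on the parallel of latitude, an angle modulo `2π`: the argument of
`ξ₁* ξ₂ = (x_ξ + i y_ξ) / 2`, hence of `ξ₂` if `ξ` is normalised so that `ξ₁ > 0`. (At the two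
poles, where the parallel is a single point, it is set to `0`.) -/
def longitude (ξ : EuclideanSpace ℂ (Fin 2)) : Real.Angle :=
  (Complex.arg (conj (ξ 0) * ξ 1) : Real.Angle)

/-- The distance `|θ_φ - θ_ξ| ∈ [0, π]` along the parallel of latitude. -/
def angularDistance (ξ φ : EuclideanSpace ℂ (Fin 2)) : ℝ :=
  |(longitude φ - longitude ξ).toReal|

end AlmostCommutative

end

noncomputable section

namespace AlmostCommutative

open MeasureTheory
open scoped SchwartzMap ContDiff Kronecker ComplexConjugate ComplexOrder

/-! The commutator `[D, a]` contains no derivative of the spinor field: it multiplies by a bounded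
continuous matrix function. Testing against concentrated bumps, `a` lies in the cone exactly when,
at every point, the quadratic form of `𝒥[D, a]` is non-positive. In the given basis this form pairs
the first spinor component with the null derivative `∂₀ + ∂₁` of `a`, the second with `∂₀ - ∂₁`, and
a mass term proportional to `d₁ - d₂` couples them through the off-diagonal entry of `a`
(`inner_causalSymbol`).

Sufficiency: write `q - p = A²(1,1) + B²(1,-1)`, so that the proper time `τ` is `2AB`. Inserting the
spinor `(A z, iB z)` bounds the mass term by the derivative of `a` along the segment. The
expectation of `a` therefore does not decrease along it while the phase of `z` turns by at most `|d₁
- d₂| τ` in total (`expectation_le_of_segment`). Straight segments maximise length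
(`IsCausalCurve.curveLength_le`), so the third condition says exactly that the angular distance is
at most `|d₁ - d₂| τ`.

Necessity: diagonal elements of the cone detect the causal order and the latitude. For the phase,
set `k = |d₁ - d₂|` and let `T` be the linear time function adapted to `q - p`, centred at the
midpoint. The functions `α = tan(kT)` and `ρ = 1/cos(kT)` satisfy `α'² - ρ'² = (kρ)²`, which is the
boundary case of the cone condition for an element with diagonal built from `α` and off-diagonal
entry from `ρ`. Its expectation drops from `p` to `q` as soon as `sin(kτ/2) < sin(|Δ|/2)`, where `Δ`
is the phase difference; this is the case when `kτ < |Δ| ≤ π` (`exists_separating`). Cutoffs turn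
`α` into a bounded causal function and `ρ` into a test function without changing the values that
matter at `p` and `q` (`exists_potential`). Lightlike pairs and `p = q` follow by moving `q`
slightly into the future. -/

/-! ## Functions with bounded derivatives -/

section BoundedDerivs

variable {E F : Type*} [NormedAddCommGroup E] [NormedSpace ℝ E]
  [NormedAddCommGroup F] [NormedSpace ℝ F]

/-- Smooth functions all of whose derivatives are bounded. -/
structure HasBoundedDerivs (g : E → F) : Prop where
  smooth : ContDiff ℝ ∞ g
  bounded : ∀ n : ℕ, ∃ C : ℝ, ∀ x, ‖iteratedFDeriv ℝ n g x‖ ≤ C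

theorem HasBoundedDerivs.add {f g : E → F} (hf : HasBoundedDerivs f) (hg : HasBoundedDerivs g) :
    HasBoundedDerivs (fun x => f x + g x) := by
  refine ⟨hf.smooth.add hg.smooth, fun n => ?_⟩
  obtain ⟨C, hC⟩ := hf.bounded n
  obtain ⟨K, hK⟩ := hg.bounded n
  refine ⟨C + K, fun x => ?_⟩
  have : iteratedFDeriv ℝ n (fun x => f x + g x) x =
      iteratedFDeriv ℝ n f x + iteratedFDeriv ℝ n g x :=
    iteratedFDeriv_add_apply (hf.smooth.of_le (mod_cast le_top)).contDiffAt
      (hg.smooth.of_le (mod_cast le_top)).contDiffAt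
  rw [this]
  exact (norm_add_le _ _).trans (add_le_add (hC x) (hK x))

theorem HasBoundedDerivs.clm_comp {G : Type*} [NormedAddCommGroup G] [NormedSpace ℝ G]
    {f : E → F} (hf : HasBoundedDerivs f) (L : F →L[ℝ] G) :
    HasBoundedDerivs (fun x => L (f x)) := by
  refine ⟨L.contDiff.comp hf.smooth, fun n => ?_⟩
  obtain ⟨C, hC⟩ := hf.bounded n
  refine ⟨‖L‖ * C, fun x => ?_⟩
  refine (L.norm_iteratedFDeriv_comp_left hf.smooth.contDiffAt (mod_cast le_top)).trans ?_
  exact mul_le_mul_of_nonneg_left (hC x) (norm_nonneg L)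

theorem HasBoundedDerivs.comp_clm {G : Type*} [NormedAddCommGroup G] [NormedSpace ℝ G]
    {f : E → F} (hf : HasBoundedDerivs f) (L : G →L[ℝ] E) :
    HasBoundedDerivs (fun x => f (L x)) := by
  refine ⟨hf.smooth.comp L.contDiff, fun n => ?_⟩
  obtain ⟨C, hC⟩ := hf.bounded n
  refine ⟨C * ∏ _i : Fin n, ‖L‖, fun x => ?_⟩
  have : iteratedFDeriv ℝ n (fun x => f (L x)) x =
      (iteratedFDeriv ℝ n f (L x)).compContinuousLinearMap fun _ => L :=
    L.iteratedFDeriv_comp_right hf.smooth x (mod_cast le_top)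
  rw [this]
  refine (ContinuousMultilinearMap.norm_compContinuousLinearMap_le _ _).trans ?_
  exact mul_le_mul_of_nonneg_right (hC _) (Finset.prod_nonneg fun _ _ => norm_nonneg _)

/-- Temperate growth makes multiplication preserve Schwartz fields; the stronger boundedness is what
makes the commutator a bounded operator. -/
theorem HasBoundedDerivs.hasTemperateGrowth {f : E → F} (hf : HasBoundedDerivs f) :
    f.HasTemperateGrowth := by
  refine ⟨hf.smooth, fun n => ?_⟩
  obtain ⟨C, hC⟩ := hf.bounded n
  exact ⟨0, C, fun x => by simpa using hC x⟩

theorem HasBoundedDerivs.norm_le {f : E → F} (hf : HasBoundedDerivs f) : ∃ C, ∀ x, ‖f x‖ ≤ C := by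
  obtain ⟨C, hC⟩ := hf.bounded 0
  exact ⟨C, fun x => by simpa using hC x⟩

theorem HasBoundedDerivs.norm_fderiv_le {f : E → F} (hf : HasBoundedDerivs f) :
    ∃ C, ∀ x, ‖fderiv ℝ f x‖ ≤ C := by
  obtain ⟨C, hC⟩ := hf.bounded 1
  exact ⟨C, fun x => by simpa [norm_iteratedFDeriv_one] using hC x⟩

theorem HasBoundedDerivs.differentiable {f : E → F} (hf : HasBoundedDerivs f) :
    Differentiable ℝ f := hf.smooth.differentiable (by simp)

theorem HasBoundedDerivs.continuous_fderiv_apply {f : E → F} (hf : HasBoundedDerivs f) (e : E) :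
    Continuous fun x => fderiv ℝ f x e :=
  (hf.smooth.continuous_fderiv (by simp)).clm_apply continuous_const

theorem hasBoundedDerivs_const (c : F) : HasBoundedDerivs (fun _ : E => c) := by
  refine ⟨contDiff_const, fun n => ?_⟩
  rcases n with _ | n
  · exact ⟨‖c‖, fun x => by simp⟩
  · refine ⟨0, fun x => ?_⟩
    rw [iteratedFDeriv_const_of_ne (Nat.succ_ne_zero n)]
    simp

theorem _root_.SchwartzMap.hasBoundedDerivs (f : 𝓢(E, F)) : HasBoundedDerivs f := by
  refine ⟨f.smooth', fun n => ?_⟩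
  obtain ⟨C, hC⟩ := f.decay' 0 n
  simp only [pow_zero, one_mul] at hC
  exact ⟨C, hC⟩

/-- A bounded smooth function on the line whose derivative has compact support has bounded
derivatives. -/
theorem hasBoundedDerivs_of_deriv {f : ℝ → ℝ} (hf : ContDiff ℝ ∞ f) {C : ℝ}
    (hC : ∀ x, |f x| ≤ C) (h : HasCompactSupport (deriv f)) : HasBoundedDerivs f := by
  refine ⟨hf, fun n => ?_⟩
  rcases n with _ | n
  · exact ⟨C, fun x => by simpa using hC x⟩
  · have hd : ContDiff ℝ ∞ (deriv f) := (contDiff_infty_iff_deriv.1 hf).2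
    obtain ⟨K, hK⟩ := ((h.toSchwartzMap hd).hasBoundedDerivs).bounded n
    refine ⟨K, fun x => ?_⟩
    rw [norm_iteratedFDeriv_eq_norm_iteratedDeriv, iteratedDeriv_succ',
      ← norm_iteratedFDeriv_eq_norm_iteratedDeriv]
    exact hK x

end BoundedDerivs

theorem IsCausalFunction.hasBoundedDerivs {f : Minkowski → ℝ} (hf : IsCausalFunction f) :
    HasBoundedDerivs f := ⟨hf.smooth, hf.bounded⟩

theorem hasBoundedDerivs_of_mem_unitisationM {g : Minkowski → ℂ} (hg : g ∈ unitisationM) :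
    HasBoundedDerivs g := by
  induction hg using Submodule.span_induction with
  | mem g hg =>
    obtain ⟨f, hf, rfl⟩ := hg
    exact hf.hasBoundedDerivs.clm_comp Complex.ofRealCLM
  | zero => exact hasBoundedDerivs_const 0
  | add f g _ _ hf hg => exact hf.add hg
  | smul c f _ hf =>
    exact hf.clm_comp ((ContinuousLinearMap.lsmul ℂ ℂ c).restrictScalars ℝ)

theorem hasBoundedDerivs_entry (a : unitisation) (i j : Fin 2) :
    HasBoundedDerivs (fun x => a.1 x i j) := by
  by_cases h : i = j
  · subst h
    exact hasBoundedDerivs_of_mem_unitisationM (a.2.1 i)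
  · obtain ⟨f, hf⟩ := a.2.2 i j h
    rw [← hf]
    exact f.hasBoundedDerivs

/-! ## The symbol of the commutator -/

theorem fibreOp_add (g m n : Matrix (Fin 2) (Fin 2) ℂ) :
    fibreOp g (m + n) = fibreOp g m + fibreOp g n := by
  simp [fibreOp, Matrix.kronecker_add]

theorem fibreOp_sub (g m n : Matrix (Fin 2) (Fin 2) ℂ) :
    fibreOp g (m - n) = fibreOp g m - fibreOp g n := by
  rw [eq_sub_iff_add_eq, ← fibreOp_add, sub_add_cancel]

theorem fibreOp_smul (g : Matrix (Fin 2) (Fin 2) ℂ) (c : ℂ) (m : Matrix (Fin 2) (Fin 2) ℂ) :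
    fibreOp g (c • m) = c • fibreOp g m := by
  simp [fibreOp, Matrix.kronecker_smul]

theorem fibreOp_apply_fibreOp (g h m n : Matrix (Fin 2) (Fin 2) ℂ) (v : Fibre) :
    fibreOp g m (fibreOp h n v) = fibreOp (g * h) (m * n) v := by
  simp only [fibreOp, Matrix.mul_kronecker_mul, map_mul]
  rfl

theorem fibreOp_eq_sum (g m : Matrix (Fin 2) (Fin 2) ℂ) :
    fibreOp g m = ∑ i, ∑ j, m i j • fibreOp g (Matrix.single i j 1) := by
  let L : Matrix (Fin 2) (Fin 2) ℂ →ₗ[ℂ] (Fibre →L[ℂ] Fibre) :=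
    { toFun := fibreOp g
      map_add' := fibreOp_add g
      map_smul' := fibreOp_smul g }
  change L m = ∑ i, ∑ j, m i j • L (Matrix.single i j 1)
  conv_lhs => rw [Matrix.matrix_eq_sum_single m]
  simp only [map_sum, ← map_smul, Matrix.smul_single, smul_eq_mul, mul_one]

/-- The entrywise directional derivative of an element of the unitisation. -/
def entryDeriv (a : unitisation) (e : Minkowski) (x : Minkowski) : Matrix (Fin 2) (Fin 2) ℂ :=
  Matrix.of fun i j => fderiv ℝ (fun y => a.1 y i j) x e

/-- The matrix valued function by which the commutator `[D, a]` multiplies. -/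
def commutatorSymbol (d₁ d₂ : ℝ) (a : unitisation) (x : Minkowski) : Fibre →L[ℂ] Fibre :=
  fibreOp (-Complex.I • gamma0) (entryDeriv a (1, 0) x) +
    fibreOp (-Complex.I • gamma1) (entryDeriv a (0, 1) x) +
    fibreOp (gamma0 * gamma1) (Matrix.diagonal ![(d₁ : ℂ), (d₂ : ℂ)] * a.1 x -
      a.1 x * Matrix.diagonal ![(d₁ : ℂ), (d₂ : ℂ)])

theorem hasBoundedDerivs_fibreOp (a : unitisation) (g : Matrix (Fin 2) (Fin 2) ℂ) :
    HasBoundedDerivs (fun x => fibreOp g (a.1 x)) := by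
  have key : (fun x => fibreOp g (a.1 x)) =
      fun x => ∑ i, ∑ j, (a.1 x i j) • fibreOp g (Matrix.single i j 1) :=
    funext fun x => fibreOp_eq_sum g (a.1 x)
  rw [key]
  have h (i j : Fin 2) : HasBoundedDerivs
      fun x => (a.1 x i j) • fibreOp g (Matrix.single i j 1) :=
    (hasBoundedDerivs_entry a i j).clm_comp
      ((ContinuousLinearMap.toSpanSingleton ℂ (fibreOp g (Matrix.single i j 1))).restrictScalars ℝ)
  simp only [Fin.sum_univ_two]
  exact ((h 0 0).add (h 0 1)).add ((h 1 0).add (h 1 1))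

theorem fderiv_fibreOp (a : unitisation) (g : Matrix (Fin 2) (Fin 2) ℂ) (x e : Minkowski) :
    fderiv ℝ (fun x => fibreOp g (a.1 x)) x e = fibreOp g (entryDeriv a e x) := by
  have key : (fun x => fibreOp g (a.1 x)) =
      fun x => ∑ i, ∑ j, (a.1 x i j) • fibreOp g (Matrix.single i j 1) :=
    funext fun x => fibreOp_eq_sum g (a.1 x)
  have h (i j : Fin 2) : HasFDerivAt
      (fun x => (a.1 x i j) • fibreOp g (Matrix.single i j 1)) _ x :=
    ((hasBoundedDerivs_entry a i j).differentiable x).hasFDerivAt.smul_const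
      (fibreOp g (Matrix.single i j 1))
  rw [key, (HasFDerivAt.fun_sum fun i _ => HasFDerivAt.fun_sum fun j _ => h i j).fderiv,
    fibreOp_eq_sum]
  simp [entryDeriv]

/-- Multiplication of a Schwartz spinor field by an element of the unitisation. -/
def schwartzMul (a : unitisation) : 𝓢(Minkowski, Fibre) →L[ℂ] 𝓢(Minkowski, Fibre) :=
  SchwartzMap.bilinLeftCLM (ContinuousLinearMap.id ℂ (Fibre →L[ℂ] Fibre)).flip
    (hasBoundedDerivs_fibreOp a 1).hasTemperateGrowth

theorem schwartzMul_apply (a : unitisation) (ψ : 𝓢(Minkowski, Fibre)) (x : Minkowski) :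
    schwartzMul a ψ x = fibreOp 1 (a.1 x) (ψ x) := rfl

theorem represent_schwartzIncl (a : unitisation) (ψ : 𝓢(Minkowski, Fibre)) :
    represent a (schwartzIncl ψ) = schwartzIncl (schwartzMul a ψ) := by
  refine Lp.ext ?_
  have h1 : schwartzIncl ψ =ᵐ[volume] ψ := ψ.coeFn_toLp 2 volume
  have h2 : schwartzIncl (schwartzMul a ψ) =ᵐ[volume] schwartzMul a ψ :=
    (schwartzMul a ψ).coeFn_toLp 2 volume
  filter_upwards [coeFn_represent a (schwartzIncl ψ), h1, h2] with x h h1 h2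
  rw [h, h1, h2, schwartzMul_apply]

theorem diracSchwartz_apply (d₁ d₂ : ℝ) (ψ : 𝓢(Minkowski, Fibre)) (x : Minkowski) :
    diracSchwartz d₁ d₂ ψ x =
      fibreOp (-Complex.I • gamma0) 1 (fderiv ℝ ψ x (1, 0)) +
        fibreOp (-Complex.I • gamma1) 1 (fderiv ℝ ψ x (0, 1)) +
        fibreOp (gamma0 * gamma1) (Matrix.diagonal ![(d₁ : ℂ), (d₂ : ℂ)]) (ψ x) := rfl

theorem fderiv_schwartzMul (a : unitisation) (ψ : 𝓢(Minkowski, Fibre)) (x e : Minkowski) :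
    fderiv ℝ (schwartzMul a ψ) x e =
      fibreOp 1 (entryDeriv a e x) (ψ x) + fibreOp 1 (a.1 x) (fderiv ℝ ψ x e) := by
  have h1 := ((hasBoundedDerivs_fibreOp a 1).differentiable x).hasFDerivAt
  have h2 := ψ.hasFDerivAt x
  let B : (Fibre →L[ℂ] Fibre) →L[ℝ] Fibre →L[ℝ] Fibre :=
    (ContinuousLinearMap.id ℂ (Fibre →L[ℂ] Fibre)).bilinearRestrictScalars ℝ
  have h3 : HasFDerivAt (schwartzMul a ψ) _ x := B.hasFDerivAt_of_bilinear h1 h2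
  rw [h3.fderiv, ← fderiv_fibreOp, add_comm]
  rfl

/-- Leibniz rule: the terms with derivatives of `ψ` cancel because `γ^μ ⊗ 1` commutes with `1 ⊗ a`.
-/
theorem diracSchwartz_commutator (d₁ d₂ : ℝ) (a : unitisation) (ψ : 𝓢(Minkowski, Fibre))
    (x : Minkowski) :
    (diracSchwartz d₁ d₂ (schwartzMul a ψ) - schwartzMul a (diracSchwartz d₁ d₂ ψ)) x =
      commutatorSymbol d₁ d₂ a x (ψ x) := by
  rw [sub_apply, schwartzMul_apply, diracSchwartz_apply, diracSchwartz_apply,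
    fderiv_schwartzMul, fderiv_schwartzMul, schwartzMul_apply, commutatorSymbol]
  simp only [map_add, fibreOp_apply_fibreOp, mul_one, one_mul, fibreOp_sub,
    add_apply, sub_apply]
  abel

theorem dirac_schwartzIncl (d₁ d₂ : ℝ) (ψ : 𝓢(Minkowski, Fibre))
    (h : schwartzIncl ψ ∈ (dirac d₁ d₂).domain) :
    dirac d₁ d₂ ⟨schwartzIncl ψ, h⟩ = schwartzIncl (diracSchwartz d₁ d₂ ψ) := by
  have : (LinearEquiv.ofInjective schwartzIncl schwartzIncl_injective).symm
      ⟨schwartzIncl ψ, h⟩ = ψ := by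
    rw [LinearEquiv.symm_apply_eq]
    rfl
  change schwartzIncl (diracSchwartz d₁ d₂ ((LinearEquiv.ofInjective schwartzIncl
    schwartzIncl_injective).symm ⟨schwartzIncl ψ, h⟩)) = _
  rw [this]

/-- The domain condition is automatic, since multiplication by `a` preserves Schwartz fields. -/
theorem extendsCommutator_iff (d₁ d₂ : ℝ) (a : unitisation)
    (B : HilbertSpace →L[ℂ] HilbertSpace) :
    ExtendsCommutator d₁ d₂ a B ↔ ∀ ψ : 𝓢(Minkowski, Fibre), B (schwartzIncl ψ) =
      schwartzIncl (diracSchwartz d₁ d₂ (schwartzMul a ψ) -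
        schwartzMul a (diracSchwartz d₁ d₂ ψ)) := by
  have hdom (ψ : 𝓢(Minkowski, Fibre)) : schwartzIncl ψ ∈ (dirac d₁ d₂).domain := ⟨ψ, rfl⟩
  constructor
  · intro h ψ
    obtain ⟨h1, h2⟩ := h ⟨schwartzIncl ψ, hdom ψ⟩
    rw [h2, dirac_schwartzIncl]
    simp only [represent_schwartzIncl, dirac_schwartzIncl, map_sub]
  · intro h ψ'
    obtain ⟨ψ, hψ⟩ : ∃ ψ, schwartzIncl ψ = ψ'.1 := ψ'.2
    obtain rfl : ψ' = ⟨schwartzIncl ψ, hdom ψ⟩ := Subtype.ext hψ.symm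
    refine ⟨by rw [represent_schwartzIncl]; exact hdom _, ?_⟩
    rw [h, dirac_schwartzIncl]
    simp only [represent_schwartzIncl, dirac_schwartzIncl, map_sub]

/-! ### Boundedness of the commutator, and its sign read off pointwise from the symbol. -/

theorem continuous_fibreOp_entryDeriv (a : unitisation) (g : Matrix (Fin 2) (Fin 2) ℂ)
    (e : Minkowski) : Continuous fun x => fibreOp g (entryDeriv a e x) := by
  simp only [← fderiv_fibreOp]
  exact (hasBoundedDerivs_fibreOp a g).continuous_fderiv_apply e

theorem exists_norm_fibreOp_entryDeriv_le (a : unitisation) (g : Matrix (Fin 2) (Fin 2) ℂ)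
    (e : Minkowski) : ∃ C, ∀ x, ‖fibreOp g (entryDeriv a e x)‖ ≤ C := by
  simp only [← fderiv_fibreOp]
  obtain ⟨C, hC⟩ := (hasBoundedDerivs_fibreOp a g).norm_fderiv_le
  exact ⟨C * ‖e‖, fun x => (ContinuousLinearMap.le_opNorm _ _).trans
    (mul_le_mul_of_nonneg_right (hC x) (norm_nonneg e))⟩

theorem fibreOp_mul (g h m n : Matrix (Fin 2) (Fin 2) ℂ) :
    fibreOp (g * h) (m * n) = fibreOp g m ∘L fibreOp h n :=
  ContinuousLinearMap.ext fun v => (fibreOp_apply_fibreOp g h m n v).symm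

theorem commutatorSymbol_eq (d₁ d₂ : ℝ) (a : unitisation) (x : Minkowski) :
    commutatorSymbol d₁ d₂ a x =
      fibreOp (-Complex.I • gamma0) (entryDeriv a (1, 0) x) +
      fibreOp (-Complex.I • gamma1) (entryDeriv a (0, 1) x) +
      (fibreOp (gamma0 * gamma1) (Matrix.diagonal ![(d₁ : ℂ), (d₂ : ℂ)]) ∘L fibreOp 1 (a.1 x) -
        fibreOp 1 (a.1 x) ∘L
          fibreOp (gamma0 * gamma1) (Matrix.diagonal ![(d₁ : ℂ), (d₂ : ℂ)])) := by
  rw [← fibreOp_mul, ← fibreOp_mul, mul_one, one_mul, ← fibreOp_sub]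
  rfl

theorem continuous_commutatorSymbol (d₁ d₂ : ℝ) (a : unitisation) :
    Continuous (commutatorSymbol d₁ d₂ a) := by
  have h := (hasBoundedDerivs_fibreOp a 1).smooth.continuous
  rw [funext (commutatorSymbol_eq d₁ d₂ a)]
  exact ((continuous_fibreOp_entryDeriv a _ _).add (continuous_fibreOp_entryDeriv a _ _)).add
    ((continuous_const.clm_comp h).sub (h.clm_comp continuous_const))

theorem exists_norm_commutatorSymbol_le (d₁ d₂ : ℝ) (a : unitisation) :
    ∃ C, ∀ x, ‖commutatorSymbol d₁ d₂ a x‖ ≤ C := by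
  obtain ⟨C₀, h₀⟩ := exists_norm_fibreOp_entryDeriv_le a (-Complex.I • gamma0) (1, 0)
  obtain ⟨C₁, h₁⟩ := exists_norm_fibreOp_entryDeriv_le a (-Complex.I • gamma1) (0, 1)
  obtain ⟨C, h⟩ := (hasBoundedDerivs_fibreOp a 1).norm_le
  set L := fibreOp (gamma0 * gamma1) (Matrix.diagonal ![(d₁ : ℂ), (d₂ : ℂ)]) with hL
  refine ⟨C₀ + C₁ + (‖L‖ * C + C * ‖L‖), fun x => ?_⟩
  rw [commutatorSymbol_eq, ← hL]
  refine (norm_add₃_le).trans (add_le_add (add_le_add (h₀ x) (h₁ x)) ((norm_sub_le _ _).trans ?_))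
  exact add_le_add ((ContinuousLinearMap.opNorm_comp_le _ _).trans
      (mul_le_mul_of_nonneg_left (h x) (norm_nonneg _)))
    ((ContinuousLinearMap.opNorm_comp_le _ _).trans
      (mul_le_mul_of_nonneg_right (h x) (norm_nonneg _)))

theorem memLp_commutatorSymbol (d₁ d₂ : ℝ) (a : unitisation) :
    MemLp (commutatorSymbol d₁ d₂ a) ⊤ (volume : Measure Minkowski) := by
  obtain ⟨C, hC⟩ := exists_norm_commutatorSymbol_le d₁ d₂ a
  exact memLp_top_of_bound (continuous_commutatorSymbol d₁ d₂ a).aestronglyMeasurable C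
    (Filter.Eventually.of_forall hC)

/-- The bounded extension of the commutator `[D, a]`. -/
def commutatorOp (d₁ d₂ : ℝ) (a : unitisation) : HilbertSpace →L[ℂ] HilbertSpace :=
  (ContinuousLinearMap.id ℂ (Fibre →L[ℂ] Fibre)).holderL volume ⊤ 2 2
    (memLp_commutatorSymbol d₁ d₂ a).toLp

theorem coeFn_commutatorOp (d₁ d₂ : ℝ) (a : unitisation) (ψ : HilbertSpace) :
    commutatorOp d₁ d₂ a ψ =ᵐ[volume] fun x => commutatorSymbol d₁ d₂ a x (ψ x) := by
  have h := (ContinuousLinearMap.id ℂ (Fibre →L[ℂ] Fibre)).coeFn_holder (r := 2)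
    (memLp_commutatorSymbol d₁ d₂ a).toLp ψ
  filter_upwards [h, (memLp_commutatorSymbol d₁ d₂ a).coeFn_toLp] with x h1 h2
  exact h1.trans (by rw [h2]; rfl)

theorem extendsCommutator_commutatorOp (d₁ d₂ : ℝ) (a : unitisation) :
    ExtendsCommutator d₁ d₂ a (commutatorOp d₁ d₂ a) := by
  rw [extendsCommutator_iff]
  intro ψ
  refine Lp.ext ?_
  have h1 : schwartzIncl ψ =ᵐ[volume] ψ := ψ.coeFn_toLp 2 volume
  have h2 := (diracSchwartz d₁ d₂ (schwartzMul a ψ) -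
    schwartzMul a (diracSchwartz d₁ d₂ ψ)).coeFn_toLp 2 (volume : Measure Minkowski)
  filter_upwards [coeFn_commutatorOp d₁ d₂ a (schwartzIncl ψ), h1, h2] with x h h1 h2
  rw [h, h1]
  exact ((diracSchwartz_commutator d₁ d₂ a ψ x).symm).trans h2.symm

/-- The symbol of `𝒥[D, a]`. -/
def causalSymbol (d₁ d₂ : ℝ) (a : unitisation) (x : Minkowski) : Fibre →L[ℂ] Fibre :=
  fibreOp (Complex.I • gamma0) 1 ∘L commutatorSymbol d₁ d₂ a x

theorem continuous_causalSymbol (d₁ d₂ : ℝ) (a : unitisation) :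
    Continuous (causalSymbol d₁ d₂ a) :=
  continuous_const.clm_comp (continuous_commutatorSymbol d₁ d₂ a)

theorem inner_commutatorOp_nonpos {d₁ d₂ : ℝ} {a : unitisation}
    (h : ∀ x v, inner ℂ v (causalSymbol d₁ d₂ a x v) ≤ 0) (ψ : HilbertSpace) :
    inner ℂ ψ (fundamentalSymmetry (commutatorOp d₁ d₂ a ψ)) ≤ 0 := by
  have h1 : fundamentalSymmetry (commutatorOp d₁ d₂ a ψ) =ᵐ[volume]
      fun x => causalSymbol d₁ d₂ a x (ψ x) := by
    filter_upwards [(fibreOp (Complex.I • gamma0) 1).coeFn_compLpL (p := 2)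
      (commutatorOp d₁ d₂ a ψ), coeFn_commutatorOp d₁ d₂ a ψ] with x hx hy
    exact hx.trans (by rw [hy]; rfl)
  have h2 : inner ℂ ψ (fundamentalSymmetry (commutatorOp d₁ d₂ a ψ)) =
      ∫ x, inner ℂ (ψ x) (causalSymbol d₁ d₂ a x (ψ x)) := by
    rw [L2.inner_def]
    refine integral_congr_ae ?_
    filter_upwards [h1] with x hx
    rw [hx]
  have h3 (x : Minkowski) : inner ℂ (ψ x) (causalSymbol d₁ d₂ a x (ψ x)) =
      (((inner ℂ (ψ x) (causalSymbol d₁ d₂ a x (ψ x))).re : ℝ) : ℂ) :=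
    Complex.ext rfl (by simpa using (Complex.le_def.1 (h x (ψ x))).2)
  rw [h2, integral_congr_ae (Filter.Eventually.of_forall h3), integral_complex_ofReal]
  exact_mod_cast integral_nonpos fun x => (Complex.le_def.1 (h x (ψ x))).1

theorem mem_causalCone_of_symbol {d₁ d₂ : ℝ} {a : unitisation}
    (ha : ∀ x, (a.1 x).IsHermitian) (h : ∀ x v, inner ℂ v (causalSymbol d₁ d₂ a x v) ≤ 0) :
    a ∈ causalCone d₁ d₂ :=
  ⟨ha, commutatorOp d₁ d₂ a, extendsCommutator_commutatorOp d₁ d₂ a, inner_commutatorOp_nonpos h⟩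

/-- Localisation: if the form were positive at `x` on `v`, it would be so on a ball by continuity,
and a bump supported there times the constant spinor `v` would violate the cone condition. -/
theorem re_inner_causalSymbol_nonpos {d₁ d₂ : ℝ} {a : unitisation} (ha : a ∈ causalCone d₁ d₂)
    (x : Minkowski) (v : Fibre) : (inner ℂ v (causalSymbol d₁ d₂ a x v)).re ≤ 0 := by
  obtain ⟨-, B, hB, hneg⟩ := ha
  rw [extendsCommutator_iff] at hB
  by_contra! hpos
  set F : Minkowski → ℝ := fun y => (inner ℂ v (causalSymbol d₁ d₂ a y v)).re with hF
  have hFc : Continuous F := Complex.continuous_re.comp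
    (continuous_const.inner ((continuous_causalSymbol d₁ d₂ a).clm_apply continuous_const))
  obtain ⟨ε, hε, hball⟩ := Metric.isOpen_iff.1 (isOpen_lt continuous_const hFc) x hpos
  let f : ContDiffBump x := ⟨ε / 2, ε, half_pos hε, half_lt_self hε⟩
  have hfs : HasCompactSupport fun y => ((f y : ℂ) • v) := by
    refine f.hasCompactSupport.mono fun y hy => ?_
    rw [Function.mem_support] at hy ⊢
    contrapose! hy
    simp [hy]
  have hsm : ContDiff ℝ ∞ fun y => ((f y : ℂ) • v) :=
    (Complex.ofRealCLM.contDiff.comp f.contDiff).smul contDiff_const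
  let ψ : 𝓢(Minkowski, Fibre) := hfs.toSchwartzMap hsm
  have hψ (y : Minkowski) : ψ y = (f y : ℂ) • v := rfl
  have key := (Complex.le_def.1 (hneg (schwartzIncl ψ))).1
  have e1 : fundamentalSymmetry (B (schwartzIncl ψ)) = schwartzIncl
      (SchwartzMap.postcompCLM (fibreOp (Complex.I • gamma0) 1)
        (diracSchwartz d₁ d₂ (schwartzMul a ψ) - schwartzMul a (diracSchwartz d₁ d₂ ψ))) := by
    rw [hB]
    refine Lp.ext ?_
    set χ := diracSchwartz d₁ d₂ (schwartzMul a ψ) - schwartzMul a (diracSchwartz d₁ d₂ ψ)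
    filter_upwards [(fibreOp (Complex.I • gamma0) 1).coeFn_compLpL (p := 2) (schwartzIncl χ),
      χ.coeFn_toLp 2 (volume : Measure Minkowski),
      (SchwartzMap.postcompCLM (fibreOp (Complex.I • gamma0) 1) χ).coeFn_toLp 2
        (volume : Measure Minkowski)] with y h1 h2 h3
    refine h1.trans (Eq.trans ?_ h3.symm)
    rw [SchwartzMap.postcompCLM_apply]
    exact congrArg _ h2
  -- The commutator acts by multiplication, so the bump enters only through its square, never its
  -- derivatives.
  have e2 : inner ℂ (schwartzIncl ψ) (fundamentalSymmetry (B (schwartzIncl ψ))) =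
      ∫ y, ((f y ^ 2 : ℝ) : ℂ) * inner ℂ v (causalSymbol d₁ d₂ a y v) := by
    rw [e1]
    refine (SchwartzMap.inner_toL2_toL2_eq _ _ volume).trans
      (integral_congr_ae (Filter.Eventually.of_forall fun y => ?_))
    simp only [SchwartzMap.postcompCLM_apply]
    rw [diracSchwartz_commutator, hψ, map_smul, map_smul, inner_smul_left, inner_smul_right,
      Complex.conj_ofReal, ← mul_assoc, ← Complex.ofReal_mul, ← sq]
    rfl
  have hc : Continuous fun y => ((f y ^ 2 : ℝ) : ℂ) * inner ℂ v (causalSymbol d₁ d₂ a y v) :=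
    (Complex.continuous_ofReal.comp (f.continuous.pow 2)).mul
      (continuous_const.inner ((continuous_causalSymbol d₁ d₂ a).clm_apply continuous_const))
  have hs : HasCompactSupport
      fun y => ((f y ^ 2 : ℝ) : ℂ) * inner ℂ v (causalSymbol d₁ d₂ a y v) := by
    refine f.hasCompactSupport.mono fun y hy => ?_
    rw [Function.mem_support] at hy ⊢
    contrapose! hy
    simp [hy]
  have e3 : (∫ y, ((f y ^ 2 : ℝ) : ℂ) * inner ℂ v (causalSymbol d₁ d₂ a y v)).re =
      ∫ y, f y ^ 2 * F y := by
    refine (integral_re (hc.integrable_of_hasCompactSupport hs)).symm.trans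
      (integral_congr_ae (Filter.Eventually.of_forall fun y => ?_))
    exact Complex.re_ofReal_mul _ _
  rw [e2, e3] at key
  refine absurd key (not_le.2 ?_)
  refine ((f.continuous.pow 2).mul hFc).integral_pos_of_hasCompactSupport_nonneg_nonzero
    ?_ (fun y => ?_) (x := x) ?_
  · refine f.hasCompactSupport.mono fun y hy => ?_
    rw [Function.mem_support] at hy ⊢
    contrapose! hy
    simp [hy]
  · by_cases hy : y ∈ Metric.ball x ε
    · exact mul_nonneg (sq_nonneg _) (le_of_lt (hball hy))
    · have : f y = 0 := f.zero_of_le_dist (by simpa using hy)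
      simp [this]
  · have : f x = 1 := f.one_of_mem_closedBall (Metric.mem_closedBall_self (half_pos hε).le)
    simpa [this] using hpos.ne'

/-! ## The pointwise description of the causal cone -/

theorem fibreOp_apply (g m : Matrix (Fin 2) (Fin 2) ℂ) (v : Fibre) (i : Fin 2 × Fin 2) :
    fibreOp g m v i = ∑ k, ∑ l, g i.1 k * m i.2 l * v (k, l) := by
  change Matrix.mulVec (g ⊗ₖ m) _ i = _
  simp [Matrix.mulVec, dotProduct, Fintype.sum_prod_type, Matrix.kroneckerMap_apply]

theorem entryDeriv_isHermitian {a : unitisation} (ha : ∀ x, (a.1 x).IsHermitian)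
    (e x : Minkowski) : (entryDeriv a e x).IsHermitian := by
  ext i j
  have h : (fun y => a.1 y i j) = fun y => star (a.1 y j i) :=
    funext fun y => ((ha y).apply i j).symm
  simp only [Matrix.conjTranspose_apply, entryDeriv, Matrix.of_apply]
  rw [h, fderiv_star]
  rfl

theorem entryDeriv_apply_add (a : unitisation) (x e f : Minkowski) (i j : Fin 2) :
    entryDeriv a (e + f) x i j = entryDeriv a e x i j + entryDeriv a f x i j := by
  simp [entryDeriv]

theorem entryDeriv_apply_smul (a : unitisation) (x e : Minkowski) (c : ℝ) (i j : Fin 2) :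
    entryDeriv a (c • e) x i j = c * entryDeriv a e x i j := by
  simp [entryDeriv]

/-- Here `(γ⁰)² = -1` and `γ⁰γ¹ = diag(-1, 1)`, so the kinetic part of `𝒥[D, a]` is diagonal in the
spinor index, with one null derivative per component; only the mass term, proportional to `γ¹`,
mixes the two. -/
theorem inner_causalSymbol (d₁ d₂ : ℝ) (a : unitisation) (x : Minkowski) (v : Fibre) :
    inner ℂ v (causalSymbol d₁ d₂ a x v) =
      -((∑ i, ∑ j, conj (v (0, i)) * entryDeriv a (1, 1) x i j * v (0, j)) +
        (∑ i, ∑ j, conj (v (1, i)) * entryDeriv a (1, -1) x i j * v (1, j)) +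
        (d₁ - d₂) * (a.1 x 0 1 * (conj (v (0, 0)) * v (1, 1) - conj (v (1, 0)) * v (0, 1)) -
          a.1 x 1 0 * (conj (v (0, 1)) * v (1, 0) - conj (v (1, 1)) * v (0, 0)))) := by
  have h1 : ((1, 1) : Minkowski) = (1, 0) + (0, 1) := by simp
  have h2 : ((1, -1) : Minkowski) = (1, 0) + (-1 : ℝ) • (0, 1) := by simp
  rw [h1, h2, PiLp.inner_apply]
  simp only [entryDeriv_apply_add, entryDeriv_apply_smul, causalSymbol, commutatorSymbol,
    ContinuousLinearMap.comp_apply, add_apply, map_add, fibreOp_apply_fibreOp, PiLp.add_apply,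
    fibreOp_apply, Fintype.sum_prod_type, Fin.sum_univ_two, RCLike.inner_apply]
  simp [gamma0, gamma1, Matrix.mul_apply, Fin.sum_univ_two, Matrix.diagonal]
  ring

theorem re_sum_conj_mul_isHermitian {m : Matrix (Fin 2) (Fin 2) ℂ} (hm : m.IsHermitian)
    (z : Fin 2 → ℂ) :
    (∑ i, ∑ j, conj (z i) * m i j * z j).re =
      ‖z 0‖ ^ 2 * (m 0 0).re + ‖z 1‖ ^ 2 * (m 1 1).re + 2 * (conj (z 0) * z 1 * m 0 1).re := by
  have h : m 1 0 = conj (m 0 1) := (hm.apply 1 0).symm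
  rw [← Complex.normSq_eq_norm_sq, ← Complex.normSq_eq_norm_sq]
  simp only [Fin.sum_univ_two, h, Complex.normSq_apply, Complex.add_re, Complex.mul_re,
    Complex.mul_im, Complex.conj_re, Complex.conj_im]
  ring

theorem im_sum_conj_mul_isHermitian {m : Matrix (Fin 2) (Fin 2) ℂ} (hm : m.IsHermitian)
    (z : Fin 2 → ℂ) : (∑ i, ∑ j, conj (z i) * m i j * z j).im = 0 := by
  have h : m 1 0 = conj (m 0 1) := (hm.apply 1 0).symm
  have h0 : (m 0 0).im = 0 := Complex.conj_eq_iff_im.1 (hm.apply 0 0)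
  have h1 : (m 1 1).im = 0 := Complex.conj_eq_iff_im.1 (hm.apply 1 1)
  simp only [Fin.sum_univ_two, h, Complex.add_im, Complex.mul_re,
    Complex.mul_im, Complex.conj_re, Complex.conj_im, h0, h1]
  ring

/-- The expectation value of a Hermitian matrix, for a vector with squared moduli `r`, `s` of
its components `z₀`, `z₁` and with `m = z₀* z₁`. -/
def expectation (r s : ℝ) (m : ℂ) (b : Matrix (Fin 2) (Fin 2) ℂ) : ℝ :=
  r * (b 0 0).re + s * (b 1 1).re + 2 * (m * b 0 1).re

theorem causalCone_inequality {d₁ d₂ : ℝ} {a : unitisation} (ha : a ∈ causalCone d₁ d₂)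
    (x : Minkowski) (z : Fin 2 → ℂ) (A B : ℝ) :
    4 * A * B * (d₁ - d₂) * (conj (z 0) * z 1 * a.1 x 0 1).im ≤
      A ^ 2 * expectation (‖z 0‖ ^ 2) (‖z 1‖ ^ 2) (conj (z 0) * z 1) (entryDeriv a (1, 1) x) +
      B ^ 2 * expectation (‖z 0‖ ^ 2) (‖z 1‖ ^ 2) (conj (z 0) * z 1) (entryDeriv a (1, -1) x) := by
  -- Without the factor `i` in the second spinor component, the two contributions to the mass term
  -- would cancel.
  let v : Fibre := WithLp.toLp 2 fun i => ![(A : ℂ) * z i.2, Complex.I * B * z i.2] i.1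
  have v0 (i : Fin 2) : v (0, i) = A * z i := rfl
  have v1 (i : Fin 2) : v (1, i) = Complex.I * B * z i := rfl
  have key := re_inner_causalSymbol_nonpos ha x v
  rw [inner_causalSymbol] at key
  simp only [expectation, ← re_sum_conj_mul_isHermitian (entryDeriv_isHermitian ha.1 _ x)]
  have h : a.1 x 1 0 = conj (a.1 x 0 1) := ((ha.1 x).apply 1 0).symm
  have e1 : ∑ i, ∑ j, conj (v (0, i)) * entryDeriv a (1, 1) x i j * v (0, j) =
      ((A ^ 2 : ℝ) : ℂ) * ∑ i, ∑ j, conj (z i) * entryDeriv a (1, 1) x i j * z j := by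
    simp only [v0, Fin.sum_univ_two, map_mul, Complex.conj_ofReal]
    push_cast
    ring
  have e2 : ∑ i, ∑ j, conj (v (1, i)) * entryDeriv a (1, -1) x i j * v (1, j) =
      ((B ^ 2 : ℝ) : ℂ) * ∑ i, ∑ j, conj (z i) * entryDeriv a (1, -1) x i j * z j := by
    simp only [v1, Fin.sum_univ_two, map_mul, Complex.conj_ofReal, Complex.conj_I]
    push_cast
    ring_nf
    simp only [Complex.I_sq]
    ring
  have e3 : ((d₁ : ℂ) - d₂) * (a.1 x 0 1 * (conj (v (0, 0)) * v (1, 1) - conj (v (1, 0)) * v (0, 1)) -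
      a.1 x 1 0 * (conj (v (0, 1)) * v (1, 0) - conj (v (1, 1)) * v (0, 0))) =
      ((2 * A * B * (d₁ - d₂) : ℝ) : ℂ) * (Complex.I * (conj (z 0) * z 1 * a.1 x 0 1 -
        conj (conj (z 0) * z 1 * a.1 x 0 1))) := by
    simp only [v0, v1, h, map_mul, Complex.conj_ofReal, Complex.conj_I, Complex.conj_conj]
    push_cast
    ring
  rw [e1, e2, e3, Complex.neg_re, Complex.add_re, Complex.add_re, Complex.re_ofReal_mul,
    Complex.re_ofReal_mul, Complex.re_ofReal_mul, Complex.sub_conj] at key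
  have e4 (c : ℝ) : (Complex.I * ((c : ℂ) * Complex.I)).re = -c := by simp
  rw [e4] at key
  linarith

theorem pureState_apply_re {a : unitisation} (ha : ∀ x, (a.1 x).IsHermitian) (p : Minkowski)
    (ξ : EuclideanSpace ℂ (Fin 2)) :
    (pureState p ξ a).re =
      expectation (‖ξ 0‖ ^ 2) (‖ξ 1‖ ^ 2) (conj (ξ 0) * ξ 1) (a.1 p) :=
  re_sum_conj_mul_isHermitian (ha p) ξ

theorem pureState_le_iff {a : unitisation} (ha : ∀ x, (a.1 x).IsHermitian) (p q : Minkowski)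
    (ξ φ : EuclideanSpace ℂ (Fin 2)) :
    pureState p ξ a ≤ pureState q φ a ↔
      expectation (‖ξ 0‖ ^ 2) (‖ξ 1‖ ^ 2) (conj (ξ 0) * ξ 1) (a.1 p) ≤
      expectation (‖φ 0‖ ^ 2) (‖φ 1‖ ^ 2) (conj (φ 0) * φ 1) (a.1 q) := by
  have h (p : Minkowski) (ξ : EuclideanSpace ℂ (Fin 2)) : (pureState p ξ a).im = 0 :=
    im_sum_conj_mul_isHermitian (ha p) ξ
  rw [Complex.le_def, pureState_apply_re ha, pureState_apply_re ha, h, h]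
  simp

/-- Transport along a straight causal segment, with the phase rotating at a speed bounded by
the proper time. -/
theorem expectation_le_of_segment {d₁ d₂ : ℝ} {a : unitisation} (ha : a ∈ causalCone d₁ d₂)
    (p : Minkowski) (z : Fin 2 → ℂ) (A B θ : ℝ) (hθ : |θ| ≤ 2 * A * B * |d₁ - d₂|) :
    expectation (‖z 0‖ ^ 2) (‖z 1‖ ^ 2) (conj (z 0) * z 1) (a.1 p) ≤
      expectation (‖z 0‖ ^ 2) (‖z 1‖ ^ 2) (conj (z 0) * z 1 * Complex.exp (θ * Complex.I))
        (a.1 (p + (A ^ 2 • (1, 1) + B ^ 2 • (1, -1)))) := by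
  set e : Minkowski := A ^ 2 • (1, 1) + B ^ 2 • (1, -1) with he
  set m := conj (z 0) * z 1 with hm
  have hx (t : ℝ) : HasDerivAt (fun t : ℝ => p + t • e) e t := by
    simpa using ((hasDerivAt_id t).smul_const e).const_add p
  have hent (i j : Fin 2) (t : ℝ) : HasDerivAt (fun t : ℝ => a.1 (p + t • e) i j)
      (entryDeriv a e (p + t • e) i j) t :=
    ((hasBoundedDerivs_entry a i j).differentiable _).hasFDerivAt.comp_hasDerivAt t (hx t)
  have hexp (t : ℝ) : HasDerivAt (fun t : ℝ => m * Complex.exp ((t * θ : ℝ) * Complex.I))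
      (m * Complex.exp ((t * θ : ℝ) * Complex.I) * (θ * Complex.I)) t := by
    have h1 : HasDerivAt (fun t : ℝ => ((t * θ : ℝ) : ℂ) * Complex.I) (θ * Complex.I) t := by
      simpa using (((hasDerivAt_id t).mul_const θ).ofReal_comp).mul_const Complex.I
    simpa [mul_assoc] using (h1.cexp).const_mul m
  have hre {f : ℝ → ℂ} {f' : ℂ} {t : ℝ} (h : HasDerivAt f f' t) :
      HasDerivAt (fun t => (f t).re) f'.re t :=
    Complex.reCLM.hasFDerivAt.comp_hasDerivAt t h
  set F : ℝ → ℝ := fun t => expectation (‖z 0‖ ^ 2) (‖z 1‖ ^ 2)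
    (m * Complex.exp ((t * θ : ℝ) * Complex.I)) (a.1 (p + t • e)) with hF
  -- The second term comes from the rotating phase; it affects only the off-diagonal entry.
  have hder (t : ℝ) : HasDerivAt F (expectation (‖z 0‖ ^ 2) (‖z 1‖ ^ 2)
      (m * Complex.exp ((t * θ : ℝ) * Complex.I)) (entryDeriv a e (p + t • e)) -
      2 * θ * (m * Complex.exp ((t * θ : ℝ) * Complex.I) * a.1 (p + t • e) 0 1).im) t := by
    have h := (((hre (hent 0 0 t)).const_mul (‖z 0‖ ^ 2)).add
      ((hre (hent 1 1 t)).const_mul (‖z 1‖ ^ 2))).add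
      ((hre ((hexp t).mul (hent 0 1 t))).const_mul 2)
    refine h.congr_deriv ?_
    simp only [expectation, Complex.add_re, Complex.mul_re, Complex.mul_im, Complex.ofReal_re,
      Complex.ofReal_im, Complex.I_re, Complex.I_im]
    ring
  have hmono : Monotone F := by
    refine monotone_of_hasDerivAt_nonneg hder fun t => ?_
    set y := p + t • e
    let w : Fin 2 → ℂ := ![z 0, z 1 * Complex.exp ((t * θ : ℝ) * Complex.I)]
    have hw0 : ‖w 0‖ = ‖z 0‖ := rfl
    have hw1 : ‖w 1‖ = ‖z 1‖ := by
      change ‖z 1 * Complex.exp ((t * θ : ℝ) * Complex.I)‖ = _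
      rw [norm_mul, Complex.norm_exp_ofReal_mul_I, mul_one]
    have hwm : conj (w 0) * w 1 = m * Complex.exp ((t * θ : ℝ) * Complex.I) := by
      change conj (z 0) * (z 1 * Complex.exp ((t * θ : ℝ) * Complex.I)) = _
      rw [hm, mul_assoc]
    have h1 := causalCone_inequality ha y w A B
    -- Changing the sign of `B` flips only the mass term, so the two inequalities together bound its
    -- absolute value.
    have h2 := causalCone_inequality ha y w A (-B)
    rw [hw0, hw1, hwm] at h1 h2
    set m' := m * Complex.exp ((t * θ : ℝ) * Complex.I)
    have hsplit : expectation (‖z 0‖ ^ 2) (‖z 1‖ ^ 2) m' (entryDeriv a e y) =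
        A ^ 2 * expectation (‖z 0‖ ^ 2) (‖z 1‖ ^ 2) m' (entryDeriv a (1, 1) y) +
        B ^ 2 * expectation (‖z 0‖ ^ 2) (‖z 1‖ ^ 2) m' (entryDeriv a (1, -1) y) := by
      simp only [expectation, he, entryDeriv_apply_add, entryDeriv_apply_smul, mul_add,
        Complex.add_re, Complex.re_ofReal_mul, mul_left_comm m']
      ring
    rw [hsplit]
    have h3 : 2 * (2 * A * B * |d₁ - d₂|) * |(m' * a.1 y 0 1).im| ≤
        A ^ 2 * expectation (‖z 0‖ ^ 2) (‖z 1‖ ^ 2) m' (entryDeriv a (1, 1) y) +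
        B ^ 2 * expectation (‖z 0‖ ^ 2) (‖z 1‖ ^ 2) m' (entryDeriv a (1, -1) y) := by
      rcases abs_cases (d₁ - d₂) with ⟨h, -⟩ | ⟨h, -⟩ <;>
      rcases abs_cases (m' * a.1 y 0 1).im with ⟨h', -⟩ | ⟨h', -⟩ <;> rw [h, h'] <;> linarith
    have h4 : θ * (m' * a.1 y 0 1).im ≤ 2 * A * B * |d₁ - d₂| * |(m' * a.1 y 0 1).im| :=
      (le_abs_self _).trans ((abs_mul _ _).trans_le
        (mul_le_mul_of_nonneg_right hθ (abs_nonneg _)))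
    change 0 ≤ _ - _
    linarith
  simpa [hF] using hmono (zero_le_one' ℝ)

/-! ## Causal curves -/

/-- In null coordinates the causal cone is a quadrant, which makes causality a pair of linear
inequalities. -/
theorem isFutureCausal_iff {v : Minkowski} :
    IsFutureCausal v ↔ 0 ≤ v.1 + v.2 ∧ 0 ≤ v.1 - v.2 ∧ v ≠ 0 := by
  constructor
  · rintro ⟨h, h0⟩
    rw [metric] at h
    have := abs_le_of_sq_le_sq' (a := v.2) (b := v.1) (by nlinarith) h0.le
    exact ⟨by linarith, by linarith, fun hv => by simp [hv] at h0⟩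
  · rintro ⟨h1, h2, h3⟩
    refine ⟨by rw [metric]; nlinarith, ?_⟩
    by_contra! h
    exact h3 (Prod.ext (show v.1 = 0 by linarith) (show v.2 = 0 by linarith))

/-- The linear function `μ (x⁰ + x¹) + ν (x⁰ - x¹)`. -/
def timeFunction (μ ν : ℝ) : Minkowski →L[ℝ] ℝ :=
  μ • (ContinuousLinearMap.fst ℝ ℝ ℝ + ContinuousLinearMap.snd ℝ ℝ ℝ) +
    ν • (ContinuousLinearMap.fst ℝ ℝ ℝ - ContinuousLinearMap.snd ℝ ℝ ℝ)

theorem timeFunction_apply (μ ν : ℝ) (x : Minkowski) :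
    timeFunction μ ν x = μ * (x.1 + x.2) + ν * (x.1 - x.2) := rfl

theorem timeFunction_nonneg {μ ν : ℝ} (hμ : 0 ≤ μ) (hν : 0 ≤ ν) {v : Minkowski}
    (hv : IsFutureCausal v) : 0 ≤ timeFunction μ ν v := by
  obtain ⟨h1, h2, -⟩ := isFutureCausal_iff.1 hv
  rw [timeFunction_apply]
  positivity

section Piece

variable {γ : ℝ → Minkowski} {a b : ℝ}

theorem derivWithin_clm_comp (h : ContDiffOn ℝ 1 γ (Set.Icc a b)) (hab : a < b)
    (L : Minkowski →L[ℝ] ℝ) {t : ℝ} (ht : t ∈ Set.Icc a b) :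
    derivWithin (fun t => L (γ t)) (Set.Icc a b) t = L (derivWithin γ (Set.Icc a b) t) :=
  (L.hasFDerivAt.comp_hasDerivWithinAt t
    (h.differentiableOn one_ne_zero t ht).hasDerivWithinAt).derivWithin (uniqueDiffOn_Icc hab t ht)

theorem continuousOn_properSpeed (h : ContDiffOn ℝ 1 γ (Set.Icc a b)) (hab : a < b) :
    ContinuousOn (fun t => √(-metric (derivWithin γ (Set.Icc a b) t)
      (derivWithin γ (Set.Icc a b) t))) (Set.Icc a b) := by
  have hc := h.continuousOn_derivWithin (uniqueDiffOn_Icc hab) le_rfl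
  unfold metric
  fun_prop

/-- At break points `deriv` may take its default value `0`, so only interior points are compared;
the length integral does not see the difference. -/
theorem deriv_eq_derivWithin_of_mem_uIoo (hab : a < b) {t : ℝ} (ht : t ∈ Set.uIoo a b) :
    derivWithin γ (Set.Icc a b) t = deriv γ t := by
  rw [Set.uIoo_of_le hab.le] at ht
  exact derivWithin_of_mem_nhds (Icc_mem_nhds ht.1 ht.2)

theorem intervalIntegrable_properSpeed (h : ContDiffOn ℝ 1 γ (Set.Icc a b)) (hab : a < b) :
    IntervalIntegrable (fun t => √(-metric (deriv γ t) (deriv γ t))) volume a b := by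
  have hc := continuousOn_properSpeed h hab
  rw [← Set.uIcc_of_le hab.le] at hc
  refine hc.intervalIntegrable.congr_uIoo fun t ht => ?_
  simp only [Set.uIcc_of_le hab.le, deriv_eq_derivWithin_of_mem_uIoo hab ht]

/-- The inequality of arithmetic and geometric means for the weighted null components of `v`; the
normalisation says that the time function has unit gradient. -/
theorem properSpeed_le {μ ν : ℝ} (hμ : 0 ≤ μ) (hν : 0 ≤ ν) (hμν : 4 * (μ * ν) = 1) {v : Minkowski}
    (hv : IsFutureCausal v) : √(-metric v v) ≤ timeFunction μ ν v := by
  refine Real.sqrt_le_iff.2 ⟨timeFunction_nonneg hμ hν hv, ?_⟩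
  rw [timeFunction_apply, metric]
  have : -(-(v.1 * v.1) + v.2 * v.2) = 4 * (μ * ν) * ((v.1 + v.2) * (v.1 - v.2)) := by
    rw [hμν]; ring
  rw [this]
  nlinarith [sq_nonneg (μ * (v.1 + v.2) - ν * (v.1 - v.2))]

theorem integral_properSpeed_le (h : ContDiffOn ℝ 1 γ (Set.Icc a b)) (hab : a < b)
    (hγ : ∀ t ∈ Set.Icc a b, IsFutureCausal (derivWithin γ (Set.Icc a b) t))
    {μ ν : ℝ} (hμ : 0 ≤ μ) (hν : 0 ≤ ν) (hμν : 4 * (μ * ν) = 1) :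
    ∫ t in a..b, √(-metric (deriv γ t) (deriv γ t)) ≤
      timeFunction μ ν (γ b) - timeFunction μ ν (γ a) := by
  have hc : ContDiffOn ℝ 1 (fun t => timeFunction μ ν (γ t)) (Set.Icc a b) :=
    (timeFunction μ ν).contDiff.comp_contDiffOn h
  rw [← intervalIntegral.integral_derivWithin_Icc_of_contDiffOn_Icc hc hab.le]
  have hd : IntervalIntegrable (derivWithin (fun t => timeFunction μ ν (γ t)) (Set.Icc a b))
      volume a b := by
    have := hc.continuousOn_derivWithin (uniqueDiffOn_Icc hab) le_rfl
    rw [← Set.uIcc_of_le hab.le] at this ⊢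
    exact this.intervalIntegrable
  refine intervalIntegral.integral_mono_on_of_le_Ioo hab.le
    (intervalIntegrable_properSpeed h hab) hd fun t ht => ?_
  have ht' := Set.Ioo_subset_Icc_self ht
  rw [derivWithin_clm_comp h hab _ ht',
    ← deriv_eq_derivWithin_of_mem_uIoo hab (by rwa [Set.uIoo_of_le hab.le])]
  exact properSpeed_le hμ hν hμν (hγ t ht')

theorem monotoneOn_clm_comp (h : ContDiffOn ℝ 1 γ (Set.Icc a b)) (hab : a < b)
    {L : Minkowski →L[ℝ] ℝ} (hL : ∀ t ∈ Set.Icc a b, 0 ≤ L (derivWithin γ (Set.Icc a b) t)) :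
    MonotoneOn (fun t => L (γ t)) (Set.Icc a b) := by
  have hc : ContDiffOn ℝ 1 (fun t => L (γ t)) (Set.Icc a b) := L.contDiff.comp_contDiffOn h
  refine monotoneOn_of_deriv_nonneg (convex_Icc a b) hc.continuousOn
    ((hc.differentiableOn one_ne_zero).mono interior_subset) fun t ht => ?_
  have ht' := interior_subset ht
  rw [interior_Icc] at ht
  rw [← derivWithin_of_mem_nhds (Icc_mem_nhds ht.1 ht.2), derivWithin_clm_comp h hab L ht']
  exact hL t ht'

end Piece

theorem IsCausalCurve.monotoneOn {γ : ℝ → Minkowski} {a b : ℝ} (h : IsCausalCurve γ a b)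
    {L : Minkowski →L[ℝ] ℝ} (hL : ∀ v, IsFutureCausal v → 0 ≤ L v) :
    a ≤ b ∧ MonotoneOn (fun t => L (γ t)) (Set.Icc a b) := by
  obtain ⟨n, s, rfl, rfl, hs⟩ := h
  induction n with
  | zero => exact ⟨le_rfl, by simp⟩
  | succ n ih =>
    obtain ⟨h1, h2⟩ := ih fun i hi => hs i (hi.trans (Nat.lt_succ_self n))
    obtain ⟨h3, h4, h5⟩ := hs n (Nat.lt_succ_self n)
    refine ⟨h1.trans h3.le, ?_⟩
    rw [← Set.Icc_union_Icc_eq_Icc h1 h3.le]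
    exact h2.union_right (monotoneOn_clm_comp h4 h3 fun t ht => hL _ (h5 t ht))
      (isGreatest_Icc h1) (isLeast_Icc h3.le)

theorem IsCausalCurve.curveLength_le_timeFunction {γ : ℝ → Minkowski} {a b : ℝ}
    (h : IsCausalCurve γ a b) {μ ν : ℝ} (hμ : 0 ≤ μ) (hν : 0 ≤ ν) (hμν : 4 * (μ * ν) = 1) :
    curveLength γ a b ≤ timeFunction μ ν (γ b) - timeFunction μ ν (γ a) := by
  obtain ⟨n, s, rfl, rfl, hs⟩ := h
  have key : IntervalIntegrable (fun t => √(-metric (deriv γ t) (deriv γ t))) volume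
      (s 0) (s n) ∧ ∫ t in (s 0)..(s n), √(-metric (deriv γ t) (deriv γ t)) ≤
        timeFunction μ ν (γ (s n)) - timeFunction μ ν (γ (s 0)) := by
    induction n with
    | zero => simp
    | succ n ih =>
      obtain ⟨h1, h2⟩ := ih fun i hi => hs i (hi.trans (Nat.lt_succ_self n))
      obtain ⟨h3, h4, h5⟩ := hs n (Nat.lt_succ_self n)
      have h6 := intervalIntegrable_properSpeed h4 h3
      refine ⟨h1.trans h6, ?_⟩
      rw [← intervalIntegral.integral_add_adjacent_intervals h1 h6]
      linarith [integral_properSpeed_le h4 h3 h5 hμ hν hμν]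
  exact key.2

/-- The proper time between two points with causal separation. -/
def properTime (p q : Minkowski) : ℝ :=
  √(((q.1 - p.1) + (q.2 - p.2)) * ((q.1 - p.1) - (q.2 - p.2)))

/-- The infimum of `μA + νB` is the geometric mean, but the optimal weights degenerate when `A` or
`B` vanishes; hence the shift by `ε` and the passage to the limit. -/
theorem le_sqrt_mul_of_forall {l A B : ℝ} (hA : 0 ≤ A) (hB : 0 ≤ B)
    (h : ∀ μ ν : ℝ, 0 ≤ μ → 0 ≤ ν → 4 * (μ * ν) = 1 → l ≤ μ * A + ν * B) : l ≤ √(A * B) := by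
  have hpos (ε : ℝ) (hε : 0 < ε) : l ≤ √((A + ε) * (B + ε)) := by
    have hA' : 0 < √(A + ε) := Real.sqrt_pos.2 (by linarith)
    have hB' : 0 < √(B + ε) := Real.sqrt_pos.2 (by linarith)
    have hsA : √(A + ε) ^ 2 = A + ε := Real.sq_sqrt (by linarith)
    have hsB : √(B + ε) ^ 2 = B + ε := Real.sq_sqrt (by linarith)
    set x := √(A + ε)
    set y := √(B + ε)
    have h1 := h (y / (2 * x)) (x / (2 * y)) (by positivity) (by positivity) (by field_simp; norm_num)
    rw [← hsA, ← hsB, ← mul_pow, Real.sqrt_sq (by positivity)]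
    refine h1.trans ?_
    have h2 : y / (2 * x) * A ≤ y / (2 * x) * x ^ 2 := by
      gcongr; linarith
    have h3 : x / (2 * y) * B ≤ x / (2 * y) * y ^ 2 := by
      gcongr; linarith
    have h4 : y / (2 * x) * x ^ 2 + x / (2 * y) * y ^ 2 = x * y := by field_simp; norm_num
    linarith
  have hlim : Filter.Tendsto (fun ε : ℝ => √((A + ε) * (B + ε))) (nhdsWithin 0 (Set.Ioi 0))
      (nhds (√(A * B))) := by
    have : Continuous fun ε : ℝ => √((A + ε) * (B + ε)) := by fun_prop
    simpa using (this.tendsto 0).mono_left nhdsWithin_le_nhds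
  exact ge_of_tendsto hlim (Filter.eventually_of_mem self_mem_nhdsWithin hpos)

theorem IsCausalCurve.null_coordinates_le {γ : ℝ → Minkowski} {a b : ℝ}
    (h : IsCausalCurve γ a b) :
    0 ≤ ((γ b).1 - (γ a).1) + ((γ b).2 - (γ a).2) ∧
      0 ≤ ((γ b).1 - (γ a).1) - ((γ b).2 - (γ a).2) := by
  have h1 (μ ν : ℝ) (hμ : 0 ≤ μ) (hν : 0 ≤ ν) : timeFunction μ ν (γ a) ≤ timeFunction μ ν (γ b) := by
    obtain ⟨hab, hm⟩ := h.monotoneOn fun v hv => timeFunction_nonneg hμ hν hv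
    exact hm (Set.left_mem_Icc.2 hab) (Set.right_mem_Icc.2 hab) hab
  have h2 := h1 1 0 zero_le_one le_rfl
  have h3 := h1 0 1 le_rfl zero_le_one
  simp only [timeFunction_apply] at h2 h3
  exact ⟨by linarith, by linarith⟩

/-- Reverse triangle inequality: every normalised linear time function bounds the length, and the
best one yields the proper time. -/
theorem IsCausalCurve.curveLength_le {γ : ℝ → Minkowski} {a b : ℝ} (h : IsCausalCurve γ a b) :
    curveLength γ a b ≤ properTime (γ a) (γ b) := by
  obtain ⟨h1, h2⟩ := h.null_coordinates_le
  refine le_sqrt_mul_of_forall h1 h2 fun μ ν hμ hν hμν => ?_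
  have h4 := h.curveLength_le_timeFunction hμ hν hμν
  simp only [timeFunction_apply] at h4
  linarith

/-- The straight segment realises the proper time. -/
theorem exists_isCausalCurve {p q : Minkowski} (h1 : 0 ≤ (q.1 - p.1) + (q.2 - p.2))
    (h2 : 0 ≤ (q.1 - p.1) - (q.2 - p.2)) :
    ∃ (γ : ℝ → Minkowski) (a b : ℝ), IsCausalCurve γ a b ∧ γ a = p ∧ γ b = q ∧
      curveLength γ a b = properTime p q := by
  -- The zero vector is not causal, so coinciding points need the trivial curve with no pieces.
  by_cases hpq : p = q
  · subst hpq
    exact ⟨fun _ => p, 0, 0, ⟨0, fun _ => 0, rfl, rfl, by simp⟩, rfl, rfl,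
      by simp [curveLength, properTime]⟩
  · have hv : IsFutureCausal (q - p) :=
      isFutureCausal_iff.2 ⟨h1, h2, sub_ne_zero.2 (Ne.symm hpq)⟩
    have hd (t : ℝ) : HasDerivAt (fun t : ℝ => p + t • (q - p)) (q - p) t := by
      simpa using ((hasDerivAt_id t).smul_const (q - p)).const_add p
    refine ⟨fun t => p + t • (q - p), 0, 1, ⟨1, fun i => i, by simp, by simp, fun i hi => ?_⟩,
      by simp, by simp, ?_⟩
    · have hi' : (i : ℝ) < ((i + 1 : ℕ) : ℝ) := by simp
      refine ⟨hi', by fun_prop, fun t ht => ?_⟩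
      rwa [((hd t).hasDerivWithinAt).derivWithin (uniqueDiffOn_Icc hi' t ht)]
    · simp only [curveLength, (hd _).deriv, properTime, metric]
      simp only [intervalIntegral.integral_const, sub_zero, one_smul]
      congr 1
      simp only [Prod.fst_sub, Prod.snd_sub]
      ring

theorem precedes_iff {p q : Minkowski} :
    Precedes p q ↔ 0 ≤ (q.1 - p.1) + (q.2 - p.2) ∧ 0 ≤ (q.1 - p.1) - (q.2 - p.2) := by
  constructor
  · rintro ⟨γ, a, b, h, rfl, rfl⟩
    exact h.null_coordinates_le
  · rintro ⟨h1, h2⟩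
    obtain ⟨γ, a, b, h, ha, hb, -⟩ := exists_isCausalCurve h1 h2
    exact ⟨γ, a, b, h, ha, hb⟩

/-- Monotone functions of a time function are causal functions. -/
theorem isCausalFunction_comp_timeFunction {f : ℝ → ℝ} (hf : HasBoundedDerivs f) (hm : Monotone f)
    {μ ν : ℝ} (hμ : 0 ≤ μ) (hν : 0 ≤ ν) :
    IsCausalFunction fun x => f (timeFunction μ ν x) where
  smooth := (hf.comp_clm _).smooth
  bounded := (hf.comp_clm _).bounded
  mono _ _ _ h := hm.comp_monotoneOn
    (h.monotoneOn fun _ hv => timeFunction_nonneg hμ hν hv).2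

theorem IsCausalFunction.add {f g : Minkowski → ℝ} (hf : IsCausalFunction f)
    (hg : IsCausalFunction g) : IsCausalFunction fun x => f x + g x where
  smooth := (hf.hasBoundedDerivs.add hg.hasBoundedDerivs).smooth
  bounded := (hf.hasBoundedDerivs.add hg.hasBoundedDerivs).bounded
  mono γ a b h := (hf.mono γ a b h).add (hg.mono γ a b h)

theorem IsCausalFunction.mul_left {f : Minkowski → ℝ} (hf : IsCausalFunction f) {c : ℝ}
    (hc : 0 ≤ c) : IsCausalFunction fun x => c * f x where
  smooth := (hf.hasBoundedDerivs.clm_comp (ContinuousLinearMap.mul ℝ ℝ c)).smooth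
  bounded := (hf.hasBoundedDerivs.clm_comp (ContinuousLinearMap.mul ℝ ℝ c)).bounded
  mono γ a b h := fun _ hx _ hy hxy => mul_le_mul_of_nonneg_left (hf.mono γ a b h hx hy hxy) hc

theorem isCausalFunction_const (c : ℝ) : IsCausalFunction fun _ => c where
  smooth := contDiff_const
  bounded := (hasBoundedDerivs_const c).bounded
  mono _ _ _ _ := monotoneOn_const

/-! ## Elements of the causal cone -/

theorem inner_causalSymbol_of_isHermitian (d₁ d₂ : ℝ) {a : unitisation}
    (ha : ∀ x, (a.1 x).IsHermitian) (x : Minkowski) (v : Fibre) :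
    inner ℂ v (causalSymbol d₁ d₂ a x v) =
      ((-(expectation (‖v (0, 0)‖ ^ 2) (‖v (0, 1)‖ ^ 2) (conj (v (0, 0)) * v (0, 1))
          (entryDeriv a (1, 1) x) +
        expectation (‖v (1, 0)‖ ^ 2) (‖v (1, 1)‖ ^ 2) (conj (v (1, 0)) * v (1, 1))
          (entryDeriv a (1, -1) x) +
        2 * (d₁ - d₂) * (a.1 x 0 1 * (conj (v (0, 0)) * v (1, 1) -
          conj (v (1, 0)) * v (0, 1))).re) : ℝ) : ℂ) := by
  have hsum {m : Matrix (Fin 2) (Fin 2) ℂ} (hm : m.IsHermitian) (z : Fin 2 → ℂ) :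
      ∑ i, ∑ j, conj (z i) * m i j * z j =
        ((expectation (‖z 0‖ ^ 2) (‖z 1‖ ^ 2) (conj (z 0) * z 1) m : ℝ) : ℂ) :=
    Complex.ext (re_sum_conj_mul_isHermitian hm z) (im_sum_conj_mul_isHermitian hm z)
  have h : a.1 x 1 0 = conj (a.1 x 0 1) := ((ha x).apply 1 0).symm
  rw [inner_causalSymbol, hsum (entryDeriv_isHermitian ha _ x) fun i => v (0, i),
    hsum (entryDeriv_isHermitian ha _ x) fun i => v (1, i), h]
  have e : a.1 x 0 1 * (conj (v (0, 0)) * v (1, 1) - conj (v (1, 0)) * v (0, 1)) -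
      conj (a.1 x 0 1) * (conj (v (0, 1)) * v (1, 0) - conj (v (1, 1)) * v (0, 0)) =
      ((2 * (a.1 x 0 1 * (conj (v (0, 0)) * v (1, 1) - conj (v (1, 0)) * v (0, 1))).re : ℝ) : ℂ) := by
    rw [← Complex.add_conj]
    simp only [map_mul, map_sub, Complex.conj_conj]
    ring
  rw [e]
  push_cast
  ring

/-- The numbers `y₀, y₁` and `z₀, z₁` stand for the internal components of the first and second
spinor component. -/
theorem mem_causalCone_of_forall {d₁ d₂ : ℝ} {a : unitisation}
    (ha : ∀ x, (a.1 x).IsHermitian)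
    (h : ∀ (x : Minkowski) (y₀ y₁ z₀ z₁ : ℂ), 0 ≤
      expectation (‖y₀‖ ^ 2) (‖y₁‖ ^ 2) (conj y₀ * y₁) (entryDeriv a (1, 1) x) +
      expectation (‖z₀‖ ^ 2) (‖z₁‖ ^ 2) (conj z₀ * z₁) (entryDeriv a (1, -1) x) +
      2 * (d₁ - d₂) * (a.1 x 0 1 * (conj y₀ * z₁ - conj z₀ * y₁)).re) :
    a ∈ causalCone d₁ d₂ := by
  refine mem_causalCone_of_symbol ha fun x v => ?_
  rw [inner_causalSymbol_of_isHermitian d₁ d₂ ha]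
  exact_mod_cast neg_nonpos.2 (h x _ _ _ _)

/-- The Hermitian element with diagonal entries `f`, `g` and upper off-diagonal entry `c`. -/
def hermitianElement {f g : Minkowski → ℝ} (hf : IsCausalFunction f) (hg : IsCausalFunction g)
    (c : 𝓢(Minkowski, ℂ)) : unitisation :=
  ⟨fun x => !![(f x : ℂ), c x; conj (c x), (g x : ℂ)], by
    constructor
    · intro i
      fin_cases i
      · exact Submodule.subset_span ⟨f, hf, rfl⟩
      · exact Submodule.subset_span ⟨g, hg, rfl⟩
    · intro i j hij
      fin_cases i <;> fin_cases j
      · exact absurd rfl hij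
      · exact ⟨c, rfl⟩
      · exact ⟨SchwartzMap.postcompCLM (𝕜 := ℝ) Complex.conjCLE.toContinuousLinearMap c, rfl⟩
      · exact absurd rfl hij⟩

section hermitianElement

variable {f g : Minkowski → ℝ} (hf : IsCausalFunction f) (hg : IsCausalFunction g)
  (c : 𝓢(Minkowski, ℂ))

theorem hermitianElement_isHermitian (x : Minkowski) :
    ((hermitianElement hf hg c).1 x).IsHermitian := by
  ext i j
  fin_cases i <;> fin_cases j <;> simp [hermitianElement]

theorem fderiv_ofReal {f : Minkowski → ℝ} (hf : Differentiable ℝ f) (x e : Minkowski) :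
    fderiv ℝ (fun y => (f y : ℂ)) x e = ((fderiv ℝ f x e : ℝ) : ℂ) := by
  have : HasFDerivAt (fun y => (f y : ℂ)) (Complex.ofRealCLM ∘L fderiv ℝ f x) x :=
    Complex.ofRealCLM.hasFDerivAt.comp x (hf x).hasFDerivAt
  rw [this.fderiv]
  rfl

theorem expectation_entryDeriv_hermitianElement (r s : ℝ) (m : ℂ) (x e : Minkowski) :
    expectation r s m (entryDeriv (hermitianElement hf hg c) e x) =
      r * fderiv ℝ f x e + s * fderiv ℝ g x e + 2 * (m * fderiv ℝ c x e).re := by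
  have h0 : entryDeriv (hermitianElement hf hg c) e x 0 0 = ((fderiv ℝ f x e : ℝ) : ℂ) :=
    fderiv_ofReal hf.hasBoundedDerivs.differentiable x e
  have h1 : entryDeriv (hermitianElement hf hg c) e x 1 1 = ((fderiv ℝ g x e : ℝ) : ℂ) :=
    fderiv_ofReal hg.hasBoundedDerivs.differentiable x e
  have h2 : entryDeriv (hermitianElement hf hg c) e x 0 1 = fderiv ℝ c x e := rfl
  rw [expectation, h0, h1, h2, Complex.ofReal_re, Complex.ofReal_re]

theorem expectation_hermitianElement (r s : ℝ) (m : ℂ) (x : Minkowski) :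
    expectation r s m ((hermitianElement hf hg c).1 x) =
      r * f x + s * g x + 2 * (m * c x).re := rfl

end hermitianElement

theorem IsCausalFunction.fderiv_nonneg {f : Minkowski → ℝ} (hf : IsCausalFunction f)
    (x : Minkowski) {e : Minkowski} (he : IsFutureCausal e) : 0 ≤ fderiv ℝ f x e := by
  have hd (t : ℝ) : HasDerivAt (fun t : ℝ => x + t • e) e t := by
    simpa using ((hasDerivAt_id t).smul_const e).const_add x
  have hc : IsCausalCurve (fun t : ℝ => x + t • e) 0 1 := by
    refine ⟨1, fun i => i, by simp, by simp, fun i hi => ?_⟩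
    have hi' : (i : ℝ) < ((i + 1 : ℕ) : ℝ) := by simp
    refine ⟨hi', by fun_prop, fun t ht => ?_⟩
    rwa [((hd t).hasDerivWithinAt).derivWithin (uniqueDiffOn_Icc hi' t ht)]
  have h0 : HasDerivAt (fun t : ℝ => f (x + t • e)) (fderiv ℝ f x e) 0 := by
    have := (hf.hasBoundedDerivs.differentiable (x + (0 : ℝ) • e)).hasFDerivAt.comp_hasDerivAt 0
      (hd 0)
    rw [zero_smul, add_zero] at this
    exact this
  have h1 := (hf.mono _ _ _ hc).derivWithin_nonneg (x := 0)
  rwa [h0.hasDerivWithinAt.derivWithin (uniqueDiffOn_Icc zero_lt_one 0 (by simp))] at h1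

theorem isFutureCausal_one_one : IsFutureCausal (1, 1) := by norm_num [IsFutureCausal, metric]

theorem isFutureCausal_one_neg_one : IsFutureCausal (1, -1) := by
  norm_num [IsFutureCausal, metric]

theorem hermitianElement_zero_mem_causalCone (d₁ d₂ : ℝ) {f g : Minkowski → ℝ}
    (hf : IsCausalFunction f) (hg : IsCausalFunction g) :
    hermitianElement hf hg 0 ∈ causalCone d₁ d₂ := by
  refine mem_causalCone_of_forall (hermitianElement_isHermitian hf hg 0) fun x y₀ y₁ z₀ z₁ => ?_
  have hc : fderiv ℝ (0 : 𝓢(Minkowski, ℂ)) x = 0 := fderiv_const_apply (0 : ℂ)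
  have h01 : (hermitianElement hf hg 0).1 x 0 1 = 0 := rfl
  rw [expectation_entryDeriv_hermitianElement, expectation_entryDeriv_hermitianElement, hc, h01]
  have h1 := hf.fderiv_nonneg x isFutureCausal_one_one
  have h2 := hf.fderiv_nonneg x isFutureCausal_one_neg_one
  have h3 := hg.fderiv_nonneg x isFutureCausal_one_one
  have h4 := hg.fderiv_nonneg x isFutureCausal_one_neg_one
  simp only [zero_mul, zero_apply, mul_zero, Complex.zero_re, add_zero]
  positivity

/-- Complete the square after multiplying by `U`; if `U = 0`, the discriminant condition forces `k =
0`. -/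
theorem quadratic_nonneg {U V k : ℝ} (hU : 0 ≤ U) (hV : 0 ≤ V) (hk : k ^ 2 ≤ U * V) (s t : ℝ) :
    0 ≤ U * s ^ 2 + V * t ^ 2 + 2 * k * (s * t) := by
  rcases hU.eq_or_lt with rfl | hU
  · have : k = 0 := by nlinarith
    subst this
    nlinarith [mul_nonneg hV (sq_nonneg t)]
  · have : 0 ≤ U * (U * s ^ 2 + V * t ^ 2 + 2 * k * (s * t)) := by
      nlinarith [sq_nonneg (U * s + k * t), mul_nonneg (sub_nonneg.2 hk) (sq_nonneg t)]
    exact nonneg_of_mul_nonneg_right this hU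

/-- The variables `y₀ ± y₁`, `z₀ ∓ z₁` split twice the form into two binary forms. -/
theorem quaternary_nonneg {α₁ α₂ ρ₁ ρ₂ k : ℝ} (h₁ : |ρ₁| ≤ α₁) (h₂ : |ρ₂| ≤ α₂)
    (h : k ^ 2 ≤ (α₁ + ρ₁) * (α₂ - ρ₂)) (h' : k ^ 2 ≤ (α₁ - ρ₁) * (α₂ + ρ₂)) (y₀ y₁ z₀ z₁ : ℝ) :
    0 ≤ α₁ * (y₀ ^ 2 + y₁ ^ 2) + 2 * ρ₁ * (y₀ * y₁) + α₂ * (z₀ ^ 2 + z₁ ^ 2) +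
      2 * ρ₂ * (z₀ * z₁) + 2 * k * (y₀ * z₁ - z₀ * y₁) := by
  obtain ⟨h3, h4⟩ := abs_le.1 h₁
  obtain ⟨h5, h6⟩ := abs_le.1 h₂
  have e1 := quadratic_nonneg (k := -k) (U := α₁ + ρ₁) (V := α₂ - ρ₂) (by linarith) (by linarith)
    (by rwa [neg_sq]) (y₀ + y₁) (z₀ - z₁)
  have e2 := quadratic_nonneg (U := α₁ - ρ₁) (V := α₂ + ρ₂) (by linarith) (by linarith)
    h' (y₀ - y₁) (z₀ + z₁)
  nlinarith

/-- A criterion for membership in the causal cone, for elements whose diagonal entries are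
proportional and whose off-diagonal entries have constant phase. -/
theorem hermitianElement_mem_causalCone {d₁ d₂ : ℝ} {α : Minkowski → ℝ} (hα : IsCausalFunction α)
    {r s : ℝ} (hr : 0 < r) (hs : 0 < s) {w : ℂ} (hw : ‖w‖ = 1) {ρ : Minkowski → ℝ}
    (hρ : Differentiable ℝ ρ) {c : 𝓢(Minkowski, ℂ)} (hc : ∀ x, c x = (r * s)⁻¹ * w * ρ x)
    (h₁ : ∀ x, |fderiv ℝ ρ x (1, 1)| ≤ fderiv ℝ α x (1, 1))
    (h₂ : ∀ x, |fderiv ℝ ρ x (1, -1)| ≤ fderiv ℝ α x (1, -1))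
    (h : ∀ x, ((d₁ - d₂) * ρ x) ^ 2 ≤ (fderiv ℝ α x (1, 1) + fderiv ℝ ρ x (1, 1)) *
      (fderiv ℝ α x (1, -1) - fderiv ℝ ρ x (1, -1)))
    (h' : ∀ x, ((d₁ - d₂) * ρ x) ^ 2 ≤ (fderiv ℝ α x (1, 1) - fderiv ℝ ρ x (1, 1)) *
      (fderiv ℝ α x (1, -1) + fderiv ℝ ρ x (1, -1))) :
    hermitianElement (hα.mul_left (inv_nonneg.2 (sq_nonneg r)))
      (hα.mul_left (inv_nonneg.2 (sq_nonneg s))) c ∈ causalCone d₁ d₂ := by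
  refine mem_causalCone_of_forall (hermitianElement_isHermitian _ _ c) fun x y₀ y₁ z₀ z₁ => ?_
  have hα' (k : ℝ) (e : Minkowski) :
      fderiv ℝ (fun x => k * α x) x e = k * fderiv ℝ α x e := by
    rw [fderiv_const_mul (hα.hasBoundedDerivs.differentiable x)]
    rfl
  have hc' (e : Minkowski) : fderiv ℝ c x e = (r * s)⁻¹ * w * (fderiv ℝ ρ x e : ℝ) := by
    have hρ' : DifferentiableAt ℝ (fun y => (ρ y : ℂ)) x :=
      Complex.ofRealCLM.differentiableAt.comp x (hρ x)
    rw [← fderiv_ofReal hρ, show (c : Minkowski → ℂ) = fun x => (r * s)⁻¹ * w * ρ x from funext hc,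
      fderiv_const_mul hρ']
    rfl
  have h01 : (hermitianElement (hα.mul_left (inv_nonneg.2 (sq_nonneg r)))
      (hα.mul_left (inv_nonneg.2 (sq_nonneg s))) c).1 x 0 1 = c x := rfl
  rw [expectation_entryDeriv_hermitianElement, expectation_entryDeriv_hermitianElement, h01,
    hα', hα', hα', hα', hc', hc', hc]
  set α₁ := fderiv ℝ α x (1, 1)
  set α₂ := fderiv ℝ α x (1, -1)
  set ρ₁ := fderiv ℝ ρ x (1, 1)
  set ρ₂ := fderiv ℝ ρ x (1, -1)
  have key := quaternary_nonneg (h₁ x) (h₂ x) (h x) (h' x)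
  -- Rescaling by `r`, `s` and rotating by `w` removes all three from the form, leaving real
  -- coefficients.
  obtain ⟨Y₀, rfl⟩ : ∃ Y, y₀ = r * Y := ⟨y₀ / r, by field_simp⟩
  obtain ⟨Z₀, rfl⟩ : ∃ Z, z₀ = r * Z := ⟨z₀ / r, by field_simp⟩
  have hww : w * conj w = 1 := by
    rw [Complex.mul_conj, Complex.normSq_eq_norm_sq, hw]; simp
  have hrot (y : ℂ) : ∃ Y, y = s * (conj w * Y) := ⟨w * y / s, by
    field_simp
    linear_combination (-y) * hww⟩
  obtain ⟨Y₁, rfl⟩ := hrot y₁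
  obtain ⟨Z₁, rfl⟩ := hrot z₁
  have hn (r : ℝ) (Y : ℂ) : ‖(r : ℂ) * Y‖ ^ 2 = r ^ 2 * (Y.re ^ 2 + Y.im ^ 2) := by
    rw [norm_mul, mul_pow, ← Complex.normSq_eq_norm_sq Y, Complex.normSq_apply, Complex.norm_real,
      Real.norm_eq_abs, sq_abs]
    ring
  have hn' (Y : ℂ) : ‖(s : ℂ) * (conj w * Y)‖ ^ 2 = s ^ 2 * (Y.re ^ 2 + Y.im ^ 2) := by
    rw [← hn, norm_mul, norm_mul, norm_mul, RCLike.norm_conj, hw, one_mul]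
  have hcross (A B : ℂ) (k : ℝ) : conj ((r : ℂ) * A) * (s * (conj w * B)) *
      ((((r * s)⁻¹ : ℝ) : ℂ) * w * k) = k * (conj A * B) := by
    simp only [map_mul, Complex.conj_ofReal]
    push_cast
    field_simp
    linear_combination (k * conj A * B) * hww
  have hlast : (((r * s)⁻¹ : ℝ) : ℂ) * w * (ρ x : ℝ) * (conj ((r : ℂ) * Y₀) * (s * (conj w * Z₁)) -
      conj ((r : ℂ) * Z₀) * (s * (conj w * Y₁))) =
      (ρ x : ℝ) * (conj Y₀ * Z₁ - conj Z₀ * Y₁) := by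
    linear_combination hcross Y₀ Z₁ (ρ x) - hcross Z₀ Y₁ (ρ x)
  rw [hn', hn', hn, hn, hcross, hcross, hlast, Complex.re_ofReal_mul, Complex.re_ofReal_mul,
    Complex.re_ofReal_mul]
  have e1 : r ^ 2 * (Y₀.re ^ 2 + Y₀.im ^ 2) * ((r ^ 2)⁻¹ * α₁) = (Y₀.re ^ 2 + Y₀.im ^ 2) * α₁ := by
    field_simp
  have e2 : r ^ 2 * (Z₀.re ^ 2 + Z₀.im ^ 2) * ((r ^ 2)⁻¹ * α₂) = (Z₀.re ^ 2 + Z₀.im ^ 2) * α₂ := by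
    field_simp
  have e3 : s ^ 2 * (Y₁.re ^ 2 + Y₁.im ^ 2) * ((s ^ 2)⁻¹ * α₁) = (Y₁.re ^ 2 + Y₁.im ^ 2) * α₁ := by
    field_simp
  have e4 : s ^ 2 * (Z₁.re ^ 2 + Z₁.im ^ 2) * ((s ^ 2)⁻¹ * α₂) = (Z₁.re ^ 2 + Z₁.im ^ 2) * α₂ := by
    field_simp
  rw [e1, e2, e3, e4]
  -- With real coefficients the real and imaginary parts of the variables decouple.
  have k1 := key Y₀.re Y₁.re Z₀.re Z₁.re
  have k2 := key Y₀.im Y₁.im Z₀.im Z₁.im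
  simp only [Complex.mul_re, Complex.sub_re, Complex.conj_re, Complex.conj_im]
  linarith

/-! ## Auxiliary functions of one variable -/

theorem HasBoundedDerivs.comp_add_const {f : ℝ → ℝ} (hf : HasBoundedDerivs f) (a : ℝ) :
    HasBoundedDerivs fun x => f (x + a) := by
  refine ⟨hf.smooth.comp (contDiff_id.add contDiff_const), fun n => ?_⟩
  obtain ⟨C, hC⟩ := hf.bounded n
  exact ⟨C, fun x => by rw [iteratedFDeriv_comp_add_right]; exact hC _⟩

theorem hasBoundedDerivs_smoothTransition : HasBoundedDerivs Real.smoothTransition := by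
  refine hasBoundedDerivs_of_deriv Real.smoothTransition.contDiff (C := 1) (fun x => ?_) ?_
  · rw [abs_of_nonneg (Real.smoothTransition.nonneg x)]
    exact Real.smoothTransition.le_one x
  · refine HasCompactSupport.intro (isCompact_Icc (a := (0 : ℝ)) (b := 1)) fun x hx => ?_
    rw [Set.mem_Icc, not_and_or, not_le, not_le] at hx
    rcases hx with hx | hx
    · have : Real.smoothTransition =ᶠ[nhds x] fun _ => 0 := by
        filter_upwards [Iio_mem_nhds hx] with y hy
        exact Real.smoothTransition.zero_of_nonpos (le_of_lt hy)
      rw [this.deriv_eq, deriv_const]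
    · have : Real.smoothTransition =ᶠ[nhds x] fun _ => 1 := by
        filter_upwards [Ioi_mem_nhds hx] with y hy
        exact Real.smoothTransition.one_of_one_le (le_of_lt hy)
      rw [this.deriv_eq, deriv_const]

/-- A smooth step from `0` on `(-∞, x₀ - ε]` to `1` on `[x₀, ∞)`. -/
def smoothStep (ε x₀ x : ℝ) : ℝ := Real.smoothTransition (ε⁻¹ * (x + (ε - x₀)))

theorem smoothStep_of_le {ε x₀ x : ℝ} (hε : 0 < ε) (hx : x ≤ x₀ - ε) : smoothStep ε x₀ x = 0 :=
  Real.smoothTransition.zero_of_nonpos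
    (mul_nonpos_of_nonneg_of_nonpos (inv_nonneg.2 hε.le) (by linarith))

theorem smoothStep_of_ge {ε x₀ x : ℝ} (hε : 0 < ε) (hx : x₀ ≤ x) : smoothStep ε x₀ x = 1 := by
  refine Real.smoothTransition.one_of_one_le ?_
  rw [← inv_mul_cancel₀ hε.ne']
  exact mul_le_mul_of_nonneg_left (by linarith) (inv_nonneg.2 hε.le)

theorem monotone_smoothStep {ε : ℝ} (hε : 0 < ε) (x₀ : ℝ) : Monotone (smoothStep ε x₀) :=
  fun _ _ h => Real.smoothTransition.monotone
    (mul_le_mul_of_nonneg_left (by linarith) (inv_nonneg.2 hε.le))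

theorem hasBoundedDerivs_smoothStep (ε x₀ : ℝ) : HasBoundedDerivs (smoothStep ε x₀) :=
  (hasBoundedDerivs_smoothTransition.comp_clm
    (ContinuousLinearMap.mul ℝ ℝ ε⁻¹)).comp_add_const (ε - x₀)

/-- A cutoff function `η` for the interval `[x₀, x₁]`, and a non-decreasing function `G` which
is constant on this interval and whose derivative dominates the one of `η`. -/
theorem exists_cutoff {x₀ x₁ ε R : ℝ} (h01 : x₀ ≤ x₁) (hε : 0 < ε) (hR : 0 ≤ R) :
    ∃ η G : ℝ → ℝ, ContDiff ℝ ∞ η ∧ (∀ t, 0 ≤ η t) ∧ (∀ t, η t ≤ 1) ∧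
      η x₀ = 1 ∧ η x₁ = 1 ∧ (∀ t, t ∉ Set.Icc (x₀ - ε) (x₁ + ε) → η t = 0) ∧
      HasBoundedDerivs G ∧ Monotone G ∧ (∀ t, R * |deriv η t| ≤ deriv G t) ∧ G x₀ = G x₁ := by
  set a := smoothStep ε x₀
  set b := smoothStep ε (x₁ + ε)
  have ha' := hasBoundedDerivs_smoothStep ε x₀
  have hb' := hasBoundedDerivs_smoothStep ε (x₁ + ε)
  have h0 (e x : ℝ) : 0 ≤ smoothStep ε e x := Real.smoothTransition.nonneg _
  have h1 (e x : ℝ) : smoothStep ε e x ≤ 1 := Real.smoothTransition.le_one _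
  have hda (t : ℝ) := (ha'.differentiable t).hasDerivAt
  have hdb (t : ℝ) := (hb'.differentiable t).hasDerivAt
  have hma := monotone_smoothStep hε x₀
  have hmb := monotone_smoothStep hε (x₁ + ε)
  have hG : HasBoundedDerivs fun t => R * (a t + b t) :=
    (ha'.add hb').clm_comp (ContinuousLinearMap.mul ℝ ℝ R)
  have ha0 : a x₀ = 1 := smoothStep_of_ge hε le_rfl
  have ha1 : a x₁ = 1 := smoothStep_of_ge hε h01
  have hb0 : b x₀ = 0 := smoothStep_of_le hε (by linarith)
  have hb1 : b x₁ = 0 := smoothStep_of_le hε (by linarith)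
  -- `η` rises with `a` left of `x₀` and falls with `b` right of `x₁`; adding the steps instead of
  -- subtracting them gives a monotone majorant.
  refine ⟨fun t => a t - b t, fun t => R * (a t + b t), ha'.smooth.sub hb'.smooth, fun t => ?_,
    fun t => by linarith [h1 x₀ t, h0 (x₁ + ε) t], by simp [ha0, hb0], by simp [ha1, hb1],
    fun t ht => ?_, hG, fun x y hxy => mul_le_mul_of_nonneg_left
      (add_le_add (hma hxy) (hmb hxy)) hR, fun t => ?_, by simp [ha0, hb0, ha1, hb1]⟩
  · by_cases ht : x₀ ≤ t
    · have : a t = 1 := smoothStep_of_ge hε ht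
      linarith [h1 (x₁ + ε) t]
    · have : b t = 0 := smoothStep_of_le hε (by linarith)
      linarith [h0 x₀ t]
  · rw [Set.mem_Icc, not_and_or, not_le, not_le] at ht
    rcases ht with ht | ht
    · have h2 : a t = 0 := smoothStep_of_le hε ht.le
      have h3 : b t = 0 := smoothStep_of_le hε (by linarith)
      simp only [h2, h3, sub_zero]
    · have h2 : a t = 1 := smoothStep_of_ge hε (by linarith)
      have h3 : b t = 1 := smoothStep_of_ge hε ht.le
      simp only [h2, h3, sub_self]
  · have h4 : deriv (fun t => a t - b t) t = deriv a t - deriv b t := ((hda t).sub (hdb t)).deriv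
    have h5 : deriv (fun t => R * (a t + b t)) t = R * (deriv a t + deriv b t) :=
      (((hda t).add (hdb t)).const_mul R).deriv
    rw [h4, h5]
    refine mul_le_mul_of_nonneg_left ?_ hR
    have h2 : 0 ≤ deriv a t := hma.deriv_nonneg
    have h3 : 0 ≤ deriv b t := hmb.deriv_nonneg
    rw [abs_le]
    constructor <;> linarith

/-- A smooth non-decreasing function with values bounded away from `±π/2` which is linear
near the origin. -/
theorem exists_clamp {k h : ℝ} (hk : 0 < k) (hh : 0 < h) (hkh : k * h < Real.pi / 2) :
    ∃ (κ b : ℝ → ℝ) (a m : ℝ), h < a ∧ m < Real.pi / 2 ∧ ContDiff ℝ ∞ κ ∧ HasCompactSupport b ∧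
      (∀ t, HasDerivAt κ (b t) t) ∧ (∀ t, 0 ≤ b t) ∧ (∀ t, |t| ≤ a → b t = k) ∧
      (∀ t, |κ t| ≤ m) ∧ ∀ t, |t| ≤ a → κ t = k * t := by
  -- Radii `h < a < o < π/(2k)`: `κ` has slope `k` up to `a` and is constant beyond `o`, so `|κ| ≤ k
  -- * o < π/2`. The gap between `h` and `a` leaves room for a later cutoff.
  obtain ⟨a, ha1, ha2⟩ := exists_between ((lt_div_iff₀' hk).2 hkh)
  obtain ⟨o, ho1, ho2⟩ := exists_between ha2
  have ha0 := hh.trans ha1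
  have ho0 := ha0.trans ho1
  let b : ContDiffBump (0 : ℝ) := ⟨a, o, ha0, ho1⟩
  have hd (t : ℝ) : HasDerivAt (fun t => k * ∫ x in (0 : ℝ)..t, b x) (k * b t) t :=
    (b.continuous.integral_hasStrictDerivAt 0 t).hasDerivAt.const_mul k
  have hb1 (t : ℝ) (ht : |t| ≤ a) : b t = 1 := b.one_of_mem_closedBall (by simpa using ht)
  have hb0 (t : ℝ) (ht : o ≤ |t|) : b t = 0 := b.zero_of_le_dist (by simpa using ht)
  have hbound (t : ℝ) (ht : |t| ≤ o) : |∫ x in (0 : ℝ)..t, b x| ≤ o := by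
    have := intervalIntegral.norm_integral_le_of_norm_le_const (f := b) (a := 0) (b := t) (C := 1)
      fun x _ => by
        rw [Real.norm_eq_abs, abs_of_nonneg b.nonneg]
        exact b.le_one
    rw [Real.norm_eq_abs, sub_zero, one_mul] at this
    exact this.trans ht
  have hfar (u t : ℝ) (h : ∀ x ∈ Set.uIcc u t, o ≤ |x|) (hu : |u| ≤ o) :
      |∫ x in (0 : ℝ)..t, b x| ≤ o := by
    rw [← intervalIntegral.integral_add_adjacent_intervals
      (b.continuous.intervalIntegrable 0 u) (b.continuous.intervalIntegrable u t),
      intervalIntegral.integral_congr (g := fun _ => 0) fun x hx => hb0 x (h x hx)]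
    simpa using hbound u hu
  refine ⟨fun t => k * ∫ x in (0 : ℝ)..t, b x, fun t => k * b t, a, k * o, ha1,
    (lt_div_iff₀' hk).1 ho2, ?_, b.hasCompactSupport.mul_left, hd,
    fun t => mul_nonneg hk.le b.nonneg, fun t ht => by simp only [hb1 t ht, mul_one], fun t => ?_,
    fun t ht => ?_⟩
  · refine contDiff_infty_iff_deriv.2 ⟨fun t => (hd t).differentiableAt, ?_⟩
    rw [funext fun t => (hd t).deriv]
    exact contDiff_const.mul b.contDiff
  · rw [abs_mul, abs_of_pos hk]
    refine mul_le_mul_of_nonneg_left ?_ hk.le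
    rcases le_total |t| o with ht | ht
    · exact hbound t ht
    · rcases le_abs'.1 ht with ht | ht
      · refine hfar (-o) t (fun x hx => ?_) (by rw [abs_neg, abs_of_pos ho0])
        rw [Set.uIcc_of_ge ht] at hx
        exact le_abs'.2 (Or.inl hx.2)
      · refine hfar o t (fun x hx => ?_) (by rw [abs_of_pos ho0])
        rw [Set.uIcc_of_le ht] at hx
        exact le_abs'.2 (Or.inr hx.1)
  · have : ∫ x in (0 : ℝ)..t, b x = ∫ _x in (0 : ℝ)..t, (1 : ℝ) := by
      refine intervalIntegral.integral_congr fun x hx => hb1 x (le_trans ?_ ht)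
      simpa using Set.abs_sub_left_of_mem_uIcc hx
    simp [this]

/-- The functions `tan` and `1 / cos`, suitably extended. -/
theorem exists_profile {k h : ℝ} (hk : 0 < k) (hh : 0 < h) (hkh : k * h < Real.pi / 2) (c : ℝ) :
    ∃ (f g : ℝ → ℝ) (a R : ℝ), h < a ∧ 0 ≤ R ∧ HasBoundedDerivs f ∧ Monotone f ∧ ContDiff ℝ ∞ g ∧
      (∀ t, |g t| ≤ R) ∧ (∀ t, |deriv g t| ≤ deriv f t) ∧
      (∀ t, |t - c| ≤ a → (deriv g t) ^ 2 + (k * g t) ^ 2 ≤ (deriv f t) ^ 2) ∧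
      f (c + h) - f (c - h) = 2 * Real.tan (k * h) ∧
      g (c + h) = (Real.cos (k * h))⁻¹ ∧ g (c - h) = (Real.cos (k * h))⁻¹ := by
  obtain ⟨κ, b, a, m, ha, hm, hκs, hbs, hd, hb0, hbk, hκm, hκ⟩ := exists_clamp hk hh hkh
  have hm0 : 0 ≤ m := (abs_nonneg _).trans (hκm 0)
  have hmc : 0 < Real.cos m := Real.cos_pos_of_mem_Ioo ⟨by linarith, hm⟩
  have hcm (t : ℝ) : Real.cos m ≤ Real.cos (κ t) := by
    rw [← Real.cos_abs (κ t)]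
    exact Real.cos_le_cos_of_nonneg_of_le_pi (abs_nonneg _) (by linarith [Real.pi_pos]) (hκm t)
  have hc (t : ℝ) : 0 < Real.cos (κ t) := hmc.trans_le (hcm t)
  have hf (t : ℝ) : HasDerivAt (fun t => Real.tan (κ t)) (b t * (1 / Real.cos (κ t) ^ 2)) t :=
    ((Real.hasDerivAt_tan (hc t).ne').comp t (hd t)).congr_deriv (mul_comm _ _)
  have hg (t : ℝ) : HasDerivAt (fun t => (Real.cos (κ t))⁻¹)
      (b t * (1 / Real.cos (κ t) ^ 2) * Real.sin (κ t)) t :=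
    (((Real.hasDerivAt_cos (κ t)).comp t (hd t)).inv (hc t).ne').congr_deriv (by
      simp only [Function.comp_apply]; ring)
  have hcos : ContDiff ℝ ∞ fun t => Real.cos (κ t) := Real.contDiff_cos.comp hκs
  have hinv : ContDiff ℝ ∞ fun t => (Real.cos (κ t))⁻¹ := hcos.inv fun t => (hc t).ne'
  have hfs : ContDiff ℝ ∞ fun t => Real.tan (κ t) := by
    simp only [Real.tan_eq_sin_div_cos, div_eq_mul_inv]
    exact (Real.contDiff_sin.comp hκs).mul hinv
  have hR (t : ℝ) : |(Real.cos (κ t))⁻¹| ≤ (Real.cos m)⁻¹ := by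
    rw [abs_of_pos (inv_pos.2 (hc t))]
    exact inv_anti₀ hmc (hcm t)
  have hfb (t : ℝ) : |Real.tan (κ t)| ≤ (Real.cos m)⁻¹ := by
    rw [Real.tan_eq_sin_div_cos, div_eq_mul_inv, abs_mul]
    exact (mul_le_of_le_one_left (abs_nonneg _) (Real.abs_sin_le_one _)).trans (hR t)
  have hfB : HasBoundedDerivs fun t => Real.tan (κ t) := by
    refine hasBoundedDerivs_of_deriv hfs hfb ?_
    rw [funext fun t => (hf t).deriv]
    exact hbs.mul_right
  have hnn (t : ℝ) : 0 ≤ b t * (1 / Real.cos (κ t) ^ 2) := mul_nonneg (hb0 t) (by positivity)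
  have hf' (t : ℝ) : HasDerivAt (fun t => Real.tan (κ (t + -c)))
      (b (t + -c) * (1 / Real.cos (κ (t + -c)) ^ 2)) t := (hf (t + -c)).comp_add_const t (-c)
  have hg' (t : ℝ) : HasDerivAt (fun t => (Real.cos (κ (t + -c)))⁻¹)
      (b (t + -c) * (1 / Real.cos (κ (t + -c)) ^ 2) * Real.sin (κ (t + -c))) t :=
    (hg (t + -c)).comp_add_const t (-c)
  have hκh : κ h = k * h := hκ h (by rw [abs_of_pos hh]; exact ha.le)
  have hκh' : κ (-h) = -(k * h) := by
    rw [hκ (-h) (by rw [abs_neg, abs_of_pos hh]; exact ha.le), mul_neg]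
  have e1 : c + h + -c = h := by ring
  have e2 : c - h + -c = -h := by ring
  refine ⟨fun t => Real.tan (κ (t + -c)), fun t => (Real.cos (κ (t + -c)))⁻¹, a, (Real.cos m)⁻¹,
    ha, by positivity, hfB.comp_add_const (-c),
    monotone_of_hasDerivAt_nonneg hf' fun t => hnn (t + -c),
    hinv.comp (contDiff_id.add contDiff_const), fun t => hR _, fun t => ?_, fun t ht => ?_, ?_,
    ?_, ?_⟩
  -- With slope `k` this is an equality, a form of `sin² + cos² = 1`.
  · rw [(hf' t).deriv, (hg' t).deriv, abs_mul, abs_of_nonneg (hnn _)]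
    exact mul_le_of_le_one_right (hnn _) (Real.abs_sin_le_one _)
  · rw [(hf' t).deriv, (hg' t).deriv, hbk (t + -c) (by rwa [← sub_eq_add_neg])]
    have := Real.sin_sq_add_cos_sq (κ (t + -c))
    have h0 := (hc (t + -c)).ne'
    refine le_of_eq ?_
    field_simp
    linear_combination this
  · simp only [e1, e2, hκh, hκh', Real.tan_neg]
    ring
  · simp only [e1, hκh]
  · simp only [e2, hκh', Real.cos_neg]

/-! ## Separating elements of the causal cone -/

theorem timeFunction_one_zero (x : Minkowski) : timeFunction 1 0 x = x.1 + x.2 := by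
  simp [timeFunction_apply]

theorem timeFunction_zero_one (x : Minkowski) : timeFunction 0 1 x = x.1 - x.2 := by
  simp [timeFunction_apply]

theorem hasFDerivAt_comp_timeFunction {f : ℝ → ℝ} (hf : Differentiable ℝ f) (μ ν : ℝ)
    (x : Minkowski) : HasFDerivAt (fun x => f (timeFunction μ ν x))
      (deriv f (timeFunction μ ν x) • timeFunction μ ν) x :=
  (hf _).hasDerivAt.comp_hasFDerivAt x (timeFunction μ ν).hasFDerivAt

theorem hasCompactSupport_of_null_coordinates {F : Minkowski → ℝ} {s₀ s₁ r₀ r₁ : ℝ}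
    (h : ∀ x : Minkowski, ¬(x.1 + x.2 ∈ Set.Icc s₀ s₁ ∧ x.1 - x.2 ∈ Set.Icc r₀ r₁) → F x = 0) :
    HasCompactSupport F := by
  have hc : Continuous fun y : ℝ × ℝ => ((y.1 + y.2) / 2, (y.1 - y.2) / 2) := by fun_prop
  refine HasCompactSupport.intro ((isCompact_Icc (a := s₀) (b := s₁)).prod
    (isCompact_Icc (a := r₀) (b := r₁)) |>.image hc) fun x hx => h x fun hx' => hx ?_
  refine ⟨(x.1 + x.2, x.1 - x.2), ⟨hx'.1, hx'.2⟩, Prod.ext ?_ ?_⟩ <;> simp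

/-- The terms containing a derivative of a cutoff are absorbed by `G₁'` and `G₂'`. What remains is
the product `4μν(f'² - (Hg')²)` with `H = η₁η₂ ≤ 1`, so scaling `g` down by `H` preserves the
profile inequality. -/
theorem cutoff_inequalities {μ ν f' g g' R η₁ η₂ η₁' η₂' G₁' G₂' k : ℝ}
    (hμ : 0 ≤ μ) (hν : 0 ≤ ν) (hμν : 4 * (μ * ν) = 1) (hg : |g| ≤ R) (hg' : |g'| ≤ f')
    (hη₁ : 0 ≤ η₁) (hη₁1 : η₁ ≤ 1) (hη₂ : 0 ≤ η₂) (hη₂1 : η₂ ≤ 1)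
    (h₁ : R * |η₁'| ≤ G₁') (h₂ : R * |η₂'| ≤ G₂')
    (hk : η₁ * η₂ ≠ 0 → g' ^ 2 + (k * g) ^ 2 ≤ f' ^ 2) :
    |2 * η₁' * η₂ * g + η₁ * η₂ * (2 * μ * g')| ≤ 2 * μ * f' + 2 * G₁' ∧
    |2 * η₂' * η₁ * g + η₁ * η₂ * (2 * ν * g')| ≤ 2 * ν * f' + 2 * G₂' ∧
    (k * (η₁ * η₂ * g)) ^ 2 ≤
      (2 * μ * f' + 2 * G₁' + (2 * η₁' * η₂ * g + η₁ * η₂ * (2 * μ * g'))) *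
      (2 * ν * f' + 2 * G₂' - (2 * η₂' * η₁ * g + η₁ * η₂ * (2 * ν * g'))) ∧
    (k * (η₁ * η₂ * g)) ^ 2 ≤
      (2 * μ * f' + 2 * G₁' - (2 * η₁' * η₂ * g + η₁ * η₂ * (2 * μ * g'))) *
      (2 * ν * f' + 2 * G₂' + (2 * η₂' * η₁ * g + η₁ * η₂ * (2 * ν * g'))) := by
  have hR : 0 ≤ R := (abs_nonneg g).trans hg
  have hb {η' η G' : ℝ} (h0 : 0 ≤ η) (h1 : η ≤ 1) (h : R * |η'| ≤ G') :
      |2 * η' * η * g| ≤ 2 * G' := by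
    have : |2 * η' * η * g| = 2 * (|η'| * (η * |g|)) := by
      rw [abs_mul, abs_mul, abs_mul, abs_of_nonneg h0, abs_two]; ring
    rw [this]
    have h3 : η * |g| ≤ R := by nlinarith [abs_nonneg g]
    nlinarith [mul_le_mul_of_nonneg_left h3 (abs_nonneg η')]
  obtain ⟨a1, a2⟩ := abs_le.1 (hb hη₂ hη₂1 h₁)
  obtain ⟨a3, a4⟩ := abs_le.1 (hb hη₁ hη₁1 h₂)
  set H := η₁ * η₂ with hH
  have hH0 : 0 ≤ H := mul_nonneg hη₁ hη₂
  have hH1 : H ≤ 1 := mul_le_one₀ hη₁1 hη₂ hη₂1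
  obtain ⟨c1, c2⟩ : -f' ≤ H * g' ∧ H * g' ≤ f' := by
    rw [← abs_le, abs_mul, abs_of_nonneg hH0]
    exact (mul_le_of_le_one_left (abs_nonneg _) hH1).trans hg'
  have m1 : 0 ≤ μ * (f' + H * g') := mul_nonneg hμ (by linarith)
  have m2 : 0 ≤ μ * (f' - H * g') := mul_nonneg hμ (by linarith)
  have n1 : 0 ≤ ν * (f' + H * g') := mul_nonneg hν (by linarith)
  have n2 : 0 ≤ ν * (f' - H * g') := mul_nonneg hν (by linarith)
  have key : (k * (H * g)) ^ 2 ≤ f' ^ 2 - (H * g') ^ 2 := by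
    -- Off the support of the cutoff the left side vanishes, so the profile inequality is needed
    -- only where `H ≠ 0`.
    by_cases h0 : H = 0
    · rw [h0]; nlinarith [sq_nonneg f']
    · have h3 := hk h0
      have h4 : H ^ 2 ≤ 1 := pow_le_one₀ hH0 hH1
      nlinarith [mul_le_mul_of_nonneg_left h3 (sq_nonneg H), sq_nonneg f']
  have hprod {A B : ℝ} (hA : 2 * (μ * (f' + H * g')) ≤ A) (hB : 2 * (ν * (f' - H * g')) ≤ B) :
      (k * (H * g)) ^ 2 ≤ A * B := by
    have := mul_le_mul hA hB (by linarith) (by linarith)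
    have e : 2 * (μ * (f' + H * g')) * (2 * (ν * (f' - H * g'))) =
        4 * (μ * ν) * (f' ^ 2 - (H * g') ^ 2) := by ring
    rw [e, hμν] at this
    linarith
  have hprod' {A B : ℝ} (hA : 2 * (μ * (f' - H * g')) ≤ A) (hB : 2 * (ν * (f' + H * g')) ≤ B) :
      (k * (H * g)) ^ 2 ≤ A * B := by
    have := mul_le_mul hA hB (by linarith) (by linarith)
    have e : 2 * (μ * (f' - H * g')) * (2 * (ν * (f' + H * g'))) =
        4 * (μ * ν) * (f' ^ 2 - (H * g') ^ 2) := by ring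
    rw [e, hμν] at this
    linarith
  refine ⟨abs_le.2 ⟨?_, ?_⟩, abs_le.2 ⟨?_, ?_⟩, hprod ?_ ?_, hprod' ?_ ?_⟩ <;> linarith

theorem fderiv_potential {f G₁ G₂ : ℝ → ℝ} (hf : Differentiable ℝ f) (hG₁ : Differentiable ℝ G₁)
    (hG₂ : Differentiable ℝ G₂) (μ ν : ℝ) (x e : Minkowski) :
    fderiv ℝ (fun x => f (timeFunction μ ν x) + G₁ (timeFunction 1 0 x) +
        G₂ (timeFunction 0 1 x)) x e =
      deriv f (timeFunction μ ν x) * timeFunction μ ν e +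
      deriv G₁ (timeFunction 1 0 x) * timeFunction 1 0 e +
      deriv G₂ (timeFunction 0 1 x) * timeFunction 0 1 e := by
  have h := ((hasFDerivAt_comp_timeFunction hf μ ν x).fun_add
    (hasFDerivAt_comp_timeFunction hG₁ 1 0 x)).fun_add (hasFDerivAt_comp_timeFunction hG₂ 0 1 x)
  rw [h.fderiv]
  rfl

theorem fderiv_cutoff {g η₁ η₂ : ℝ → ℝ} (hg : Differentiable ℝ g) (hη₁ : Differentiable ℝ η₁)
    (hη₂ : Differentiable ℝ η₂) (μ ν : ℝ) (x e : Minkowski) :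
    fderiv ℝ (fun x => η₁ (timeFunction 1 0 x) * η₂ (timeFunction 0 1 x) *
        g (timeFunction μ ν x)) x e =
      (deriv η₁ (timeFunction 1 0 x) * timeFunction 1 0 e * η₂ (timeFunction 0 1 x) +
        η₁ (timeFunction 1 0 x) * (deriv η₂ (timeFunction 0 1 x) * timeFunction 0 1 e)) *
          g (timeFunction μ ν x) +
      η₁ (timeFunction 1 0 x) * η₂ (timeFunction 0 1 x) *
        (deriv g (timeFunction μ ν x) * timeFunction μ ν e) := by
  have h := ((hasFDerivAt_comp_timeFunction hη₁ 1 0 x).fun_mul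
    (hasFDerivAt_comp_timeFunction hη₂ 0 1 x)).fun_mul (hasFDerivAt_comp_timeFunction hg μ ν x)
  rw [h.fderiv]
  simp only [add_apply, smul_apply, smul_eq_mul]
  ring

/-- The time function whose gradient is parallel to `q - p`. -/
theorem exists_timeFunction {p q : Minkowski} (h₁ : 0 < (q.1 - p.1) + (q.2 - p.2))
    (h₂ : 0 < (q.1 - p.1) - (q.2 - p.2)) :
    ∃ μ ν : ℝ, 0 < μ ∧ 0 < ν ∧ 4 * (μ * ν) = 1 ∧
      timeFunction μ ν q - timeFunction μ ν p = properTime p q := by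
  have hx : 0 < √((q.1 - p.1) + (q.2 - p.2)) := Real.sqrt_pos.2 h₁
  have hy : 0 < √((q.1 - p.1) - (q.2 - p.2)) := Real.sqrt_pos.2 h₂
  have hsx := Real.sq_sqrt h₁.le
  have hsy := Real.sq_sqrt h₂.le
  have hτ : properTime p q = √((q.1 - p.1) + (q.2 - p.2)) * √((q.1 - p.1) - (q.2 - p.2)) :=
    Real.sqrt_mul h₁.le _
  set X := √((q.1 - p.1) + (q.2 - p.2))
  set Y := √((q.1 - p.1) - (q.2 - p.2))
  -- The weights giving equality between arithmetic and geometric mean for the null components of `q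
  -- - p`.
  refine ⟨Y / (2 * X), X / (2 * Y), by positivity, by positivity, by field_simp; norm_num, ?_⟩
  have e : timeFunction (Y / (2 * X)) (X / (2 * Y)) q - timeFunction (Y / (2 * X)) (X / (2 * Y)) p =
      Y / (2 * X) * X ^ 2 + X / (2 * Y) * Y ^ 2 := by
    rw [hsx, hsy, timeFunction_apply, timeFunction_apply]
    ring
  rw [e, hτ]
  field_simp
  norm_num

theorem abs_timeFunction_sub_le {μ ν ε : ℝ} (hμ : 0 ≤ μ) (hν : 0 ≤ ν) {p q x : Minkowski}
    (h₁ : x.1 + x.2 ∈ Set.Icc (p.1 + p.2 - ε) (q.1 + q.2 + ε))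
    (h₂ : x.1 - x.2 ∈ Set.Icc (p.1 - p.2 - ε) (q.1 - q.2 + ε)) :
    timeFunction μ ν p - (μ + ν) * ε ≤ timeFunction μ ν x ∧
      timeFunction μ ν x ≤ timeFunction μ ν q + (μ + ν) * ε := by
  have i1 := mul_le_mul_of_nonneg_left h₁.1 hμ
  have i2 := mul_le_mul_of_nonneg_left h₁.2 hμ
  have i3 := mul_le_mul_of_nonneg_left h₂.1 hν
  have i4 := mul_le_mul_of_nonneg_left h₂.2 hν
  simp only [timeFunction_apply]
  constructor <;> linarith

/-- A causal function `α` and a test function `ρ` with the properties needed for a separating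
element of the causal cone. -/
theorem exists_potential {k : ℝ} (hk : 0 < k) {p q : Minkowski}
    (h₁ : 0 < (q.1 - p.1) + (q.2 - p.2)) (h₂ : 0 < (q.1 - p.1) - (q.2 - p.2))
    (hπ : k * (properTime p q / 2) < Real.pi / 2) :
    ∃ α ρ : Minkowski → ℝ, IsCausalFunction α ∧ ContDiff ℝ ∞ ρ ∧ HasCompactSupport ρ ∧
      (∀ x, |fderiv ℝ ρ x (1, 1)| ≤ fderiv ℝ α x (1, 1) ∧
        |fderiv ℝ ρ x (1, -1)| ≤ fderiv ℝ α x (1, -1) ∧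
        (k * ρ x) ^ 2 ≤ (fderiv ℝ α x (1, 1) + fderiv ℝ ρ x (1, 1)) *
          (fderiv ℝ α x (1, -1) - fderiv ℝ ρ x (1, -1)) ∧
        (k * ρ x) ^ 2 ≤ (fderiv ℝ α x (1, 1) - fderiv ℝ ρ x (1, 1)) *
          (fderiv ℝ α x (1, -1) + fderiv ℝ ρ x (1, -1))) ∧
      α q - α p = 2 * Real.tan (k * (properTime p q / 2)) ∧
      ρ p = (Real.cos (k * (properTime p q / 2)))⁻¹ ∧
      ρ q = (Real.cos (k * (properTime p q / 2)))⁻¹ := by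
  obtain ⟨μ, ν, hμ0, hν0, hμν, hT⟩ := exists_timeFunction h₁ h₂
  have hh0 : 0 < properTime p q / 2 := half_pos (Real.sqrt_pos.2 (mul_pos h₁ h₂))
  set h := properTime p q / 2 with hh
  obtain ⟨c, hc⟩ : ∃ c, c = timeFunction μ ν p + h := ⟨_, rfl⟩
  have hTp : timeFunction μ ν p = c - h := by rw [hc]; ring
  have hTq : timeFunction μ ν q = c + h := by linarith
  obtain ⟨f, g, a, R, ha, hR, hfB, hfm, hgs, hgR, hgf, hfg, hf, hgq, hgp⟩ :=
    exists_profile hk hh0 hπ c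
  -- Enlarging the null rectangle between `p` and `q` by `ε` changes the time function by at most
  -- `(μ + ν) * ε = a - h`, so the cutoff stays where the profile inequality holds.
  obtain ⟨ε, hε⟩ : ∃ ε, ε = (a - h) / (μ + ν) := ⟨_, rfl⟩
  have hε0 : 0 < ε := by rw [hε]; exact div_pos (by linarith) (by linarith)
  have hεa : (μ + ν) * ε = a - h := by rw [hε]; field_simp
  obtain ⟨η₁, G₁, hη₁s, hη₁0, hη₁1, hη₁p, hη₁q, hη₁z, hG₁B, hG₁m, hηG₁, hG₁⟩ :=
    exists_cutoff (x₀ := p.1 + p.2) (x₁ := q.1 + q.2) (by linarith) hε0 hR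
  obtain ⟨η₂, G₂, hη₂s, hη₂0, hη₂1, hη₂p, hη₂q, hη₂z, hG₂B, hG₂m, hηG₂, hG₂⟩ :=
    exists_cutoff (x₀ := p.1 - p.2) (x₁ := q.1 - q.2) (by linarith) hε0 hR
  have hαc : IsCausalFunction fun x => f (timeFunction μ ν x) + G₁ (timeFunction 1 0 x) +
      G₂ (timeFunction 0 1 x) :=
    ((isCausalFunction_comp_timeFunction hfB hfm hμ0.le hν0.le).add
      (isCausalFunction_comp_timeFunction hG₁B hG₁m zero_le_one le_rfl)).add
      (isCausalFunction_comp_timeFunction hG₂B hG₂m le_rfl zero_le_one)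
  have hρs : ContDiff ℝ ∞ fun x => η₁ (timeFunction 1 0 x) * η₂ (timeFunction 0 1 x) *
      g (timeFunction μ ν x) :=
    ((hη₁s.comp (timeFunction 1 0).contDiff).mul (hη₂s.comp (timeFunction 0 1).contDiff)).mul
      (hgs.comp (timeFunction μ ν).contDiff)
  have hρ0 (x : Minkowski) (hx : ¬(x.1 + x.2 ∈ Set.Icc (p.1 + p.2 - ε) (q.1 + q.2 + ε) ∧
      x.1 - x.2 ∈ Set.Icc (p.1 - p.2 - ε) (q.1 - q.2 + ε))) :
      η₁ (timeFunction 1 0 x) * η₂ (timeFunction 0 1 x) = 0 := by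
    rw [timeFunction_one_zero, timeFunction_zero_one]
    rcases not_and_or.1 hx with hx | hx
    · rw [hη₁z _ hx, zero_mul]
    · rw [hη₂z _ hx, mul_zero]
  have hρc : HasCompactSupport fun x => η₁ (timeFunction 1 0 x) * η₂ (timeFunction 0 1 x) *
      g (timeFunction μ ν x) := hasCompactSupport_of_null_coordinates fun x hx =>
    (congrArg (· * g (timeFunction μ ν x)) (hρ0 x hx)).trans (zero_mul _)
  have key (x : Minkowski) := cutoff_inequalities (k := k) hμ0.le hν0.le hμν
    (hgR (timeFunction μ ν x)) (hgf (timeFunction μ ν x)) (hη₁0 (timeFunction 1 0 x))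
    (hη₁1 (timeFunction 1 0 x)) (hη₂0 (timeFunction 0 1 x)) (hη₂1 (timeFunction 0 1 x))
    (hηG₁ (timeFunction 1 0 x)) (hηG₂ (timeFunction 0 1 x)) (fun hne => by
      obtain ⟨hx1, hx2⟩ := not_not.1 fun hx => hne (hρ0 x hx)
      obtain ⟨i1, i2⟩ := abs_timeFunction_sub_le hμ0.le hν0.le hx1 hx2
      exact hfg _ (abs_le.2 ⟨by linarith, by linarith⟩))
  have t1 : timeFunction 1 0 (1, 1) = 2 := by norm_num [timeFunction_apply]
  have t2 : timeFunction 1 0 (1, -1) = 0 := by norm_num [timeFunction_apply]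
  have t3 : timeFunction 0 1 (1, 1) = 0 := by norm_num [timeFunction_apply]
  have t4 : timeFunction 0 1 (1, -1) = 2 := by norm_num [timeFunction_apply]
  have t5 : timeFunction μ ν (1, 1) = 2 * μ := by rw [timeFunction_apply]; ring
  have t6 : timeFunction μ ν (1, -1) = 2 * ν := by rw [timeFunction_apply]; ring
  have hα' (x e : Minkowski) := fderiv_potential hfB.differentiable hG₁B.differentiable
    hG₂B.differentiable μ ν x e
  have hρ' (x e : Minkowski) := fderiv_cutoff (hgs.differentiable (by simp))
    (hη₁s.differentiable (by simp)) (hη₂s.differentiable (by simp)) μ ν x e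
  refine ⟨_, _, hαc, hρs, hρc, fun x => ?_, ?_, ?_, ?_⟩
  · rw [hα', hα', hρ', hρ', t1, t2, t3, t4, t5, t6]
    obtain ⟨k1, k2, k3, k4⟩ := key x
    refine ⟨(congrArg abs ?_).trans_le (k1.trans_eq ?_), (congrArg abs ?_).trans_le
      (k2.trans_eq ?_), k3.trans_eq ?_, k4.trans_eq ?_⟩ <;> ring
  -- `G₁` and `G₂` take equal values at `p` and `q`, so only `f` contributes.
  · simp only [timeFunction_one_zero, timeFunction_zero_one, hTp, hTq, hG₁, hG₂]
    linarith
  · simp only [timeFunction_one_zero, timeFunction_zero_one, hTp, hη₁p, hη₂p, hgp, one_mul]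
  · simp only [timeFunction_one_zero, timeFunction_zero_one, hTq, hη₁q, hη₂q, hgq, one_mul]

theorem exists_separating {d₁ d₂ : ℝ} (hd : d₁ ≠ d₂) {p q : Minkowski}
    (h₁ : 0 < (q.1 - p.1) + (q.2 - p.2)) (h₂ : 0 < (q.1 - p.1) - (q.2 - p.2))
    (hπ : |d₁ - d₂| * (properTime p q / 2) < Real.pi / 2) {σ : ℝ}
    (hσ : Real.sin (|d₁ - d₂| * (properTime p q / 2)) < σ) {r s : ℝ} (hr : 0 < r) (hs : 0 < s)
    {w : ℂ} (hw : ‖w‖ = 1) :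
    ∃ a ∈ causalCone d₁ d₂, ∀ m m' : ℂ, (m * w).re = r * s * σ → (m' * w).re = -(r * s * σ) →
      expectation (r ^ 2) (s ^ 2) m' (a.1 q) < expectation (r ^ 2) (s ^ 2) m (a.1 p) := by
  have hk : 0 < |d₁ - d₂| := abs_pos.2 (sub_ne_zero.2 hd)
  obtain ⟨α, ρ, hαc, hρs, hρc, key, hα, hρp, hρq⟩ := exists_potential hk h₁ h₂ hπ
  simp only [mul_pow, sq_abs] at key
  have hcs : HasCompactSupport fun x => (((r * s)⁻¹ : ℝ) : ℂ) * w * (ρ x : ℂ) := by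
    refine hρc.mono fun x hx => ?_
    rw [Function.mem_support] at hx ⊢
    contrapose! hx
    simp [hx]
  have hcc : ContDiff ℝ ∞ fun x => (((r * s)⁻¹ : ℝ) : ℂ) * w * (ρ x : ℂ) :=
    contDiff_const.mul (Complex.ofRealCLM.contDiff.comp hρs)
  refine ⟨_, hermitianElement_mem_causalCone hαc hr hs hw (hρs.differentiable (by simp))
    (c := hcs.toSchwartzMap hcc) (fun x => rfl) (fun x => (key x).1) (fun x => (key x).2.1)
    (fun x => by rw [mul_pow]; exact (key x).2.2.1)
    (fun x => by rw [mul_pow]; exact (key x).2.2.2), fun m m' hm hm' => ?_⟩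
  rw [expectation_hermitianElement, expectation_hermitianElement]
  have hval (x : Minkowski) (m : ℂ) (σ : ℝ) (hm : (m * w).re = r * s * σ) :
      r ^ 2 * ((r ^ 2)⁻¹ * α x) + s ^ 2 * ((s ^ 2)⁻¹ * α x) +
        2 * (m * hcs.toSchwartzMap hcc x).re = 2 * (α x + ρ x * σ) := by
    have e : m * hcs.toSchwartzMap hcc x = (((r * s)⁻¹ * ρ x : ℝ) : ℂ) * (m * w) := by
      change m * ((((r * s)⁻¹ : ℝ) : ℂ) * w * (ρ x : ℂ)) = _
      push_cast
      ring
    rw [e, Complex.re_ofReal_mul, hm]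
    field_simp
    ring
  -- The expectation changes by `4 (tan θ - σ / cos θ)` from `p` to `q`, negative exactly because
  -- `sin θ < σ`.
  rw [hval p m σ hm, hval q m' (-σ) (by rw [hm']; ring)]
  set θ := |d₁ - d₂| * (properTime p q / 2)
  have hθ : 0 ≤ θ := mul_nonneg hk.le (div_nonneg (Real.sqrt_nonneg _) zero_le_two)
  have hcos : 0 < Real.cos θ := Real.cos_pos_of_mem_Ioo ⟨by linarith [Real.pi_pos], hπ⟩
  have hlt : Real.tan θ < (Real.cos θ)⁻¹ * σ := by
    rw [Real.tan_eq_sin_div_cos, div_eq_inv_mul]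
    exact mul_lt_mul_of_pos_left hσ (inv_pos.2 hcos)
  rw [hρp, hρq]
  linarith

/-! ## Causality between pure states -/

/-- The arguments are subtracted modulo `2π`, which the exponential does not notice; for `m = m' =
0` the phase is irrelevant. -/
theorem eq_mul_exp_of_norm_eq {m m' : ℂ} (h : ‖m‖ = ‖m'‖) :
    m' = m * Complex.exp ((((Complex.arg m' : Real.Angle) - (Complex.arg m : Real.Angle)).toReal :
      ℝ) * Complex.I) := by
  set θ : Real.Angle := (Complex.arg m' : Real.Angle) - (Complex.arg m : Real.Angle) with hθ
  have h1 : ((Complex.arg m' - Complex.arg m : ℝ) : Real.Angle) = (θ.toReal : Real.Angle) := by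
    rw [Real.Angle.coe_toReal, Real.Angle.coe_sub]
  obtain ⟨n, hn⟩ := Real.Angle.angle_eq_iff_two_pi_dvd_sub.1 h1
  have h2 : Complex.exp (θ.toReal * Complex.I) =
      Complex.exp ((Complex.arg m' : ℝ) * Complex.I - (Complex.arg m : ℝ) * Complex.I) := by
    refine Complex.exp_eq_exp_iff_exists_int.2 ⟨-n, ?_⟩
    have h3 : θ.toReal = Complex.arg m' - Complex.arg m - 2 * Real.pi * n := by linarith
    rw [h3]
    push_cast
    ring
  rw [h2]
  nth_rewrite 1 [← Complex.norm_mul_exp_arg_mul_I m']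
  nth_rewrite 1 [← Complex.norm_mul_exp_arg_mul_I m]
  rw [mul_assoc, ← Complex.exp_add, h, add_sub_cancel]

theorem conj_mul_eq_mul_exp {ξ φ : EuclideanSpace ℂ (Fin 2)} (h0 : ‖ξ 0‖ = ‖φ 0‖)
    (h1 : ‖ξ 1‖ = ‖φ 1‖) :
    conj (φ 0) * φ 1 = conj (ξ 0) * ξ 1 *
      Complex.exp ((longitude φ - longitude ξ).toReal * Complex.I) :=
  eq_mul_exp_of_norm_eq (by simp [h0, h1])

theorem norm_sq_add_norm_sq {ξ : EuclideanSpace ℂ (Fin 2)} (hξ : ‖ξ‖ = 1) :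
    ‖ξ 0‖ ^ 2 + ‖ξ 1‖ ^ 2 = 1 := by
  have := EuclideanSpace.norm_sq_eq ξ
  rw [hξ, Fin.sum_univ_two] at this
  linarith

theorem norm_eq_of_latitude_eq {ξ φ : EuclideanSpace ℂ (Fin 2)} (hξ : ‖ξ‖ = 1) (hφ : ‖φ‖ = 1)
    (h : latitude ξ = latitude φ) : ‖ξ 0‖ = ‖φ 0‖ ∧ ‖ξ 1‖ = ‖φ 1‖ := by
  have h1 := norm_sq_add_norm_sq hξ
  have h2 := norm_sq_add_norm_sq hφ
  rw [latitude, latitude] at h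
  constructor <;> refine (sq_eq_sq₀ (norm_nonneg _) (norm_nonneg _)).1 ?_ <;> linarith

/-! ### Sufficiency of the conditions. -/

theorem causallyPrecedes_of_le_properTime {d₁ d₂ : ℝ} {p q : Minkowski}
    {ξ φ : EuclideanSpace ℂ (Fin 2)} (h₁ : 0 ≤ (q.1 - p.1) + (q.2 - p.2))
    (h₂ : 0 ≤ (q.1 - p.1) - (q.2 - p.2)) (h0 : ‖ξ 0‖ = ‖φ 0‖) (h1 : ‖ξ 1‖ = ‖φ 1‖)
    (h : angularDistance ξ φ ≤ |d₁ - d₂| * properTime p q) :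
    CausallyPrecedes d₁ d₂ (pureState p ξ) (pureState q φ) := by
  intro a ha
  rw [pureState_le_iff ha.1, ← h0, ← h1, conj_mul_eq_mul_exp h0 h1]
  have hA := Real.sq_sqrt (div_nonneg h₁ zero_le_two)
  have hB := Real.sq_sqrt (div_nonneg h₂ zero_le_two)
  -- The two roots are the `A` and `B` with `q - p = A²(1,1) + B²(1,-1)`.
  have hAB : properTime p q = 2 * √(((q.1 - p.1) + (q.2 - p.2)) / 2) *
      √(((q.1 - p.1) - (q.2 - p.2)) / 2) := by
    rw [mul_assoc, ← Real.sqrt_mul (div_nonneg h₁ zero_le_two), properTime,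
      Real.sqrt_eq_iff_mul_self_eq (mul_nonneg h₁ h₂) (by positivity), mul_mul_mul_comm,
      Real.mul_self_sqrt (by positivity)]
    ring
  rw [hAB, mul_comm] at h
  have key := expectation_le_of_segment ha p ξ _ _ _ h
  rw [hA, hB] at key
  convert key using 3
  ext <;> simp <;> ring

/-! ### Necessity of the conditions. -/

theorem timeFunction_le_of_causallyPrecedes {d₁ d₂ : ℝ} {p q : Minkowski}
    {ξ φ : EuclideanSpace ℂ (Fin 2)} (hξ : ‖ξ‖ = 1)
    (h : CausallyPrecedes d₁ d₂ (pureState p ξ) (pureState q φ)) {μ ν : ℝ} (hμ : 0 ≤ μ)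
    (hν : 0 ≤ ν) : timeFunction μ ν p ≤ timeFunction μ ν q := by
  by_contra! hlt
  have hε : 0 < timeFunction μ ν p - timeFunction μ ν q := sub_pos.2 hlt
  set ε := timeFunction μ ν p - timeFunction μ ν q with hεdef
  have hf := isCausalFunction_comp_timeFunction
    (hasBoundedDerivs_smoothStep ε (timeFunction μ ν p))
    (monotone_smoothStep hε (timeFunction μ ν p)) hμ hν
  -- If the time function decreased, this multiple of the identity would have expectation `1` at `p`
  -- and `0` at `q`.
  have key := h _ (hermitianElement_zero_mem_causalCone d₁ d₂ hf hf)
  rw [pureState_le_iff (hermitianElement_isHermitian hf hf 0), expectation_hermitianElement,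
    expectation_hermitianElement, smoothStep_of_ge hε le_rfl,
    smoothStep_of_le hε (by rw [hεdef]; linarith)] at key
  simp only [zero_apply, mul_zero, Complex.zero_re, mul_one, add_zero, norm_sq_add_norm_sq hξ] at key
  linarith

/-- The constants `diag(c, 0)` lie in the cone for both signs of `c`, so the moduli of the first
components agree. -/
theorem latitude_eq_of_causallyPrecedes {d₁ d₂ : ℝ} {p q : Minkowski}
    {ξ φ : EuclideanSpace ℂ (Fin 2)} (hξ : ‖ξ‖ = 1) (hφ : ‖φ‖ = 1)
    (h : CausallyPrecedes d₁ d₂ (pureState p ξ) (pureState q φ)) : latitude ξ = latitude φ := by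
  have key (c : ℝ) : ‖ξ 0‖ ^ 2 * c ≤ ‖φ 0‖ ^ 2 * c := by
    have := h _ (hermitianElement_zero_mem_causalCone d₁ d₂ (isCausalFunction_const c)
      (isCausalFunction_const 0))
    rw [pureState_le_iff (hermitianElement_isHermitian _ _ 0), expectation_hermitianElement,
      expectation_hermitianElement] at this
    simpa using this
  have h1 := norm_sq_add_norm_sq hξ
  have h2 := norm_sq_add_norm_sq hφ
  rw [latitude, latitude]
  linarith [key 1, key (-1)]

theorem le_properTime_of_causallyPrecedes_of_timelike {d₁ d₂ : ℝ} (hd : d₁ ≠ d₂) {p q : Minkowski}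
    {ξ φ : EuclideanSpace ℂ (Fin 2)} (h₁ : 0 < (q.1 - p.1) + (q.2 - p.2))
    (h₂ : 0 < (q.1 - p.1) - (q.2 - p.2)) (h0 : ‖ξ 0‖ = ‖φ 0‖) (h1 : ‖ξ 1‖ = ‖φ 1‖)
    (h : CausallyPrecedes d₁ d₂ (pureState p ξ) (pureState q φ)) :
    angularDistance ξ φ ≤ |d₁ - d₂| * properTime p q := by
  by_contra! hlt
  have hτ : 0 ≤ |d₁ - d₂| * properTime p q := mul_nonneg (abs_nonneg _) (Real.sqrt_nonneg _)
  have hm := conj_mul_eq_mul_exp h0 h1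
  rw [angularDistance] at hlt
  have hpi := Real.Angle.abs_toReal_le_pi (longitude φ - longitude ξ)
  -- At a pole both longitudes are `0`, contradicting a positive angular distance; so `ξ` has no
  -- vanishing component.
  have hr : 0 < ‖ξ 0‖ := by
    rw [norm_pos_iff]
    intro hz
    have hz' : φ 0 = 0 := by rw [← norm_eq_zero, ← h0, hz, norm_zero]
    simp [longitude, hz, hz'] at hlt
    linarith
  have hs : 0 < ‖ξ 1‖ := by
    rw [norm_pos_iff]
    intro hz
    have hz' : φ 1 = 0 := by rw [← norm_eq_zero, ← h1, hz, norm_zero]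
    simp [longitude, hz, hz'] at hlt
    linarith
  set Δ := (longitude φ - longitude ξ).toReal
  set m := conj (ξ 0) * ξ 1 with hmdef
  have hnm : ‖m‖ = ‖ξ 0‖ * ‖ξ 1‖ := by simp [hmdef]
  obtain ⟨σ, hσ, hσΔ⟩ : ∃ σ : ℝ, |σ| = 1 ∧ σ * Real.sin (Δ / 2) = Real.sin (|Δ| / 2) := by
    rcases abs_cases Δ with ⟨h, -⟩ | ⟨h, -⟩ <;> rw [h]
    · exact ⟨1, by simp, by simp⟩
    · exact ⟨-1, by simp, by rw [neg_div, Real.sin_neg]; ring⟩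
  -- The direction a quarter turn away from the bisector of the two phases: the real parts at `ξ`
  -- and `φ` are then opposite, and the sign `σ` makes the one at `ξ` positive.
  set w : ℂ := σ * Complex.I * Complex.exp ((-(m.arg + Δ / 2) : ℝ) * Complex.I) with hw
  have hw1 : ‖w‖ = 1 := by
    rw [hw, norm_mul, Complex.norm_exp_ofReal_mul_I, norm_mul, Complex.norm_I, Complex.norm_real,
      Real.norm_eq_abs, hσ]
    norm_num
  have hmw (t : ℝ) : (m * Complex.exp (t * Complex.I) * w).re =
      ‖ξ 0‖ * ‖ξ 1‖ * (σ * Real.sin (Δ / 2 - t)) := by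
    have e : m * Complex.exp (t * Complex.I) * w =
        ((‖m‖ * σ : ℝ) : ℂ) * (Complex.I * Complex.exp ((t - Δ / 2 : ℝ) * Complex.I)) := by
      have e1 : Complex.exp ((t - Δ / 2 : ℝ) * Complex.I) = Complex.exp (m.arg * Complex.I) *
          Complex.exp (t * Complex.I) * Complex.exp ((-(m.arg + Δ / 2) : ℝ) * Complex.I) := by
        rw [← Complex.exp_add, ← Complex.exp_add]
        congr 1
        push_cast
        ring
      rw [e1, hw]
      nth_rewrite 1 [← Complex.norm_mul_exp_arg_mul_I m]
      push_cast
      ring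
    rw [e, Complex.re_ofReal_mul, hnm, Complex.I_mul_re, Complex.exp_ofReal_mul_I_im,
      ← Real.sin_neg, neg_sub]
    ring
  obtain ⟨a, ha, hsep⟩ := exists_separating hd h₁ h₂ (σ := Real.sin (|Δ| / 2))
    (by linarith) (Real.sin_lt_sin_of_lt_of_le_pi_div_two (by linarith [Real.pi_pos])
      (by linarith) (by linarith)) hr hs hw1
  have key := h a ha
  rw [pureState_le_iff ha.1, ← h0, ← h1] at key
  refine absurd key (not_le.2 (hsep _ _ ?_ ?_))
  · have := hmw 0
    rw [Complex.ofReal_zero, zero_mul, Complex.exp_zero, mul_one, sub_zero, hσΔ] at this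
    exact this
  · rw [hm, hmw, show Δ / 2 - Δ = -(Δ / 2) by ring, Real.sin_neg, mul_neg, hσΔ, mul_neg]

/-- Moving `q` to `q + (ε, 0)` makes the separation timelike and, by transitivity with sufficiency
for equal internal states, keeps the relation; then `ε → 0`. -/
theorem le_properTime_of_causallyPrecedes {d₁ d₂ : ℝ} (hd : d₁ ≠ d₂) {p q : Minkowski}
    {ξ φ : EuclideanSpace ℂ (Fin 2)} (h₁ : 0 ≤ (q.1 - p.1) + (q.2 - p.2))
    (h₂ : 0 ≤ (q.1 - p.1) - (q.2 - p.2)) (h0 : ‖ξ 0‖ = ‖φ 0‖) (h1 : ‖ξ 1‖ = ‖φ 1‖)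
    (h : CausallyPrecedes d₁ d₂ (pureState p ξ) (pureState q φ)) :
    angularDistance ξ φ ≤ |d₁ - d₂| * properTime p q := by
  have hε (ε : ℝ) (hε : 0 < ε) :
      angularDistance ξ φ ≤ |d₁ - d₂| * properTime p (q + (ε, 0)) := by
    refine le_properTime_of_causallyPrecedes_of_timelike hd ?_ ?_ h0 h1 fun a ha =>
      (h a ha).trans (causallyPrecedes_of_le_properTime (d₁ := d₁) (d₂ := d₂) ?_ ?_ rfl rfl ?_ a ha)
    · simp only [Prod.fst_add, Prod.snd_add]; linarith
    · simp only [Prod.fst_add, Prod.snd_add]; linarith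
    · simp only [Prod.fst_add, Prod.snd_add]; linarith
    · simp only [Prod.fst_add, Prod.snd_add]; linarith
    · simp only [angularDistance, sub_self, Real.Angle.toReal_zero, abs_zero]
      exact mul_nonneg (abs_nonneg _) (Real.sqrt_nonneg _)
  have hlim : Filter.Tendsto (fun ε : ℝ => |d₁ - d₂| * properTime p (q + (ε, 0)))
      (nhdsWithin 0 (Set.Ioi 0)) (nhds (|d₁ - d₂| * properTime p q)) := by
    have : Continuous fun ε : ℝ => |d₁ - d₂| * properTime p (q + (ε, 0)) := by
      simp only [properTime, Prod.fst_add, Prod.snd_add]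
      fun_prop
    have h2 := (this.tendsto 0).mono_left (nhdsWithin_le_nhds (s := Set.Ioi 0))
    rwa [show q + ((0 : ℝ), (0 : ℝ)) = q from add_zero q] at h2
  exact ge_of_tendsto hlim (Filter.eventually_of_mem self_mem_nhdsWithin hε)

end AlmostCommutative

end

/-! ### The equivalence. -/

theorem theorem3p6 (d₁ d₂ : ℝ) (hd : d₁ ≠ d₂) (p q : AlmostCommutative.Minkowski)
    (ξ φ : EuclideanSpace ℂ (Fin 2)) (hξ : ‖ξ‖ = 1) (hφ : ‖φ‖ = 1) :
    AlmostCommutative.CausallyPrecedes d₁ d₂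
        (AlmostCommutative.pureState p ξ) (AlmostCommutative.pureState q φ) ↔
      AlmostCommutative.Precedes p q ∧
      AlmostCommutative.latitude ξ = AlmostCommutative.latitude φ ∧
      ∃ (γ : ℝ → AlmostCommutative.Minkowski) (a b : ℝ),
        AlmostCommutative.IsCausalCurve γ a b ∧ γ a = p ∧ γ b = q ∧
        AlmostCommutative.angularDistance ξ φ / |d₁ - d₂| ≤
          AlmostCommutative.curveLength γ a b := by
  open AlmostCommutative in
  have hk : 0 < |d₁ - d₂| := abs_pos.2 (sub_ne_zero.2 hd)
  constructor
  · intro h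
    have h₁ := timeFunction_le_of_causallyPrecedes hξ h zero_le_one le_rfl
    have h₂ := timeFunction_le_of_causallyPrecedes hξ h le_rfl zero_le_one
    rw [timeFunction_one_zero, timeFunction_one_zero] at h₁
    rw [timeFunction_zero_one, timeFunction_zero_one] at h₂
    have h₁' : 0 ≤ (q.1 - p.1) + (q.2 - p.2) := by linarith
    have h₂' : 0 ≤ (q.1 - p.1) - (q.2 - p.2) := by linarith
    have hl := latitude_eq_of_causallyPrecedes hξ hφ h
    obtain ⟨h0, h1⟩ := norm_eq_of_latitude_eq hξ hφ hl
    obtain ⟨γ, a, b, hγ, ha, hb, hlen⟩ := exists_isCausalCurve h₁' h₂'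
    refine ⟨precedes_iff.2 ⟨h₁', h₂'⟩, hl, γ, a, b, hγ, ha, hb, ?_⟩
    rw [hlen, div_le_iff₀' hk]
    exact le_properTime_of_causallyPrecedes hd h₁' h₂' h0 h1 h
  · rintro ⟨hpq, hl, γ, a, b, hγ, rfl, rfl, hlen⟩
    obtain ⟨h₁, h₂⟩ := precedes_iff.1 hpq
    obtain ⟨h0, h1⟩ := norm_eq_of_latitude_eq hξ hφ hl
    refine causallyPrecedes_of_le_properTime h₁ h₂ h0 h1 ?_
    rw [← div_le_iff₀' hk]
    exact hlen.trans hγ.curveLength_le
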